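/- Let $\mu$ be a finite positive Borel measure on $\mathbb{R}^2$. For $t>0$ let $\mu_t(E)=\mu(t^{-1}E)$, and let \[ M_\mu g(x)=\sup_{t>0}\,(|g|*\mu_t)(x)=\sup_{t>0}\int_{\mathbb{R}^2}|g(x-y)|\,d\mu_t(y)\in[0,\infty]. \] Suppose that for every $2<r<\infty$ the operator $M_\mu$ is bounded on $L^r(\mathbb{R}^2)$, that is, there is $C_r<\infty$ with $\|M_\mu g\|_{L^r(\mathbb{R}^2)}\le C_r\|g\|_{L^r(\mathbb{R}^2)}$ for all $g\in L^r(\mathbb{R}^2)$. Let $1\le p<\tfrac43$ and $\tfrac1p+\tfrac1{p'}=1$ (with $p'=\infty$ if $p=1$). Then there is a constant $C_{p,\mu}<\infty$, depending only on $p$ and $\mu$, such that for every $q\in[1,\infty]$ with $3q\le p'$ and every $f\in L^1(\mathbb{R}^2)\cap L^p(\mathbb{R}^2)$ (in particular for every Schwartz function $f$), \[ \|M_\mu(\widehat f)\|_{L^q(\mathbb{S}^1)}\le C_{p,\mu}\,\|f\|_{L^p(\mathbb{R}^2)}, \] where $\widehat f(\xi)=\int_{\mathbb{R}^2}e^{-2\pi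 i x\cdot\xi}f(x)\,dx$ and $\mathbb{S}^1$ carries arc-length measure. -/

import Mathlib

open MeasureTheory
open scoped ENNReal NNReal FourierTransform

noncomputable section

/-- The Euclidean plane. -/
abbrev Plane : Type := EuclideanSpace ℝ (Fin 2)

/-- The dilate `μ_t(E) = μ(t⁻¹ E)` of a measure on the plane (`t > 0`), as the push-forward of `μ`
under `y ↦ t y`. -/
def dilate (μ : Measure Plane) (t : ℝ) : Measure Plane :=
  μ.map (fun y => t • y)

/-- The maximal function `M_μ g (x) = sup_{t > 0} (|g| * μ_t)(x)`, with values in `[0, ∞]`. -/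
def maximalFunction (μ : Measure Plane) (g : Plane → ℂ) (x : Plane) : ℝ≥0∞ :=
  ⨆ (t : ℝ) (_ : 0 < t), ∫⁻ y, ‖g (x - y)‖ₑ ∂(dilate μ t)

/-- `M_μ` is bounded from `L^r(ℝ²)` to `L^r(ℝ²)`. -/
def MaximalBoundedOn (μ : Measure Plane) (r : ℝ≥0∞) : Prop :=
  ∃ C : ℝ≥0, ∀ g : Plane → ℂ, MemLp g r volume →
    eLpNorm (maximalFunction μ g) r volume ≤ C * eLpNorm g r volume

/-- Arc length on the unit circle `S¹`, as a measure on the plane: the push-forward of Lebesgue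
measure on `[0, 2π)` under the unit-speed parametrization `θ ↦ (cos θ, sin θ)`. -/
def circleMeasure : Measure Plane :=
  (volume.restrict (Set.Ico 0 (2 * Real.pi))).map
    (fun θ : ℝ => (!₂[Real.cos θ, Real.sin θ] : Plane))

end

/-! The proof linearizes the supremum and dualizes. Put `r = p'/2`: then `p < 4/3` means `r > 2`,
and the critical exponent is `q = p'/3 = 2r/3`; smaller `q` follow from Hölder on the circle. Let
`γ` parametrize the circle. Over finitely many dilations the supremum is attained at `t = τ(θ)` with
`τ` measurable, and the estimate becomes dual to an `L^{2r}` bound, in terms of `‖h‖_{q'}`, for the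
Fourier transform `G` of the image of `c(θ,y) dθ dμ(y)` under `(θ,y) ↦ γ(θ) - τ(θ)y`, where
`|c(θ,y)| ≤ h(θ)`.

Since `2r > 4`, one can square `G`, in the manner of Carleson and Sjölin. The pairing `∫ F G²`
evaluates `𝓕 F` at `γ(x) + γ(x') - τ(x)y - τ(x')y'`. Bounding the two `μ`-averages one after the
other by the maximal function leaves `∬ h(x) h(x') M M(𝓕 F)(γ(x) + γ(x'))`, from which `τ` has
disappeared (`lintegral_shiftedPoint_le`). The map `(x,x') ↦ γ(x) + γ(x')` has Jacobian `|sin(x -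
x')|`, so Hölder and Hardy–Littlewood–Sobolev bound this by `‖h‖_{q'}² ‖M M(𝓕 F)‖_r`
(`lintegral_arc_mul_mul_le`). Boundedness of `M` on `L^r`, used twice, and Hausdorff–Young reduce
the last norm to `‖F‖_{r'}`. The extremal `F` gives the bound for `G`
(`exists_lintegral_extensionOperator_le`), and duality returns to the maximal function
(`exists_lintegral_arc_finiteMaximal_fourier_le`). Constants do not depend on the set of dilations,
so monotone convergence gives the full supremum. For `p = 1` the maximal function is simply bounded.
-/

/-! ### The Fourier transform on `L¹ ∩ L²`. -/

section FourierLp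

variable {E : Type*} [NormedAddCommGroup E] [InnerProductSpace ℝ E] [FiniteDimensional ℝ E]
  [MeasurableSpace E] [BorelSpace E]

theorem continuous_fourier_of_integrable {f : E → ℂ} (hf : Integrable f) : Continuous (𝓕 f) :=
  VectorFourier.fourierIntegral_continuous Real.continuous_fourierChar
    (innerSL ℝ).continuous₂ hf

theorem enorm_fourier_le (f : E → ℂ) (w : E) : ‖𝓕 f w‖ₑ ≤ ∫⁻ x, ‖f x‖ₑ := by
  rw [Real.fourier_eq]
  refine (enorm_integral_le_lintegral_enorm _).trans (le_of_eq ?_)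
  refine lintegral_congr fun x => ?_
  simp only [← ofReal_norm, Circle.norm_smul]

theorem integral_schwartz_mul_fourier {f : E → ℂ} (hf : Integrable f) (g : SchwartzMap E ℂ) :
    ∫ x, g x • 𝓕 f x = ∫ x, 𝓕 g x • f x := by
  have := VectorFourier.integral_fourierIntegral_smul_eq_flip (L := innerₗ E) (μ := volume)
    (ν := volume) Real.continuous_fourierChar continuous_inner (g.integrable (μ := volume)) hf
  rw [flip_innerₗ] at this
  rw [SchwartzMap.fourier_coe]
  exact this.symm

/-- The `L²` Fourier transform agrees with the integral formula on `L¹ ∩ L²`. -/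
theorem fourier_toLp_ae_eq {f : E → ℂ} (hf : Integrable f) (hf2 : MemLp f 2) :
    (𝓕 (hf2.toLp f) : Lp ℂ 2 (volume : Measure E)) =ᵐ[volume] 𝓕 f := by
  refine ae_eq_of_integral_contDiff_smul_eq ((Lp.memLp _).locallyIntegrable (by norm_num))
    (continuous_fourier_of_integrable hf).locallyIntegrable fun g hg hc => ?_
  -- Smooth compactly supported real test functions separate locally integrable functions; made
  -- complex, they are Schwartz and can be paired with tempered distributions.
  have hg₁ : HasCompactSupport (Complex.ofRealCLM ∘ g) := hc.comp_left rfl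
  have hg₂ : ContDiff ℝ (⊤ : ℕ∞) (Complex.ofRealCLM ∘ g) := by fun_prop
  set φ : SchwartzMap E ℂ := hg₁.toSchwartzMap hg₂ with hφ
  have h1 := congrArg (fun T => T φ) (Lp.fourier_toTemperedDistribution_eq (hf2.toLp f))
  simp only [TemperedDistribution.fourier_apply, Lp.toTemperedDistribution_apply] at h1
  have h2 := integral_schwartz_mul_fourier hf φ
  have h3 : ∫ x, 𝓕 φ x • hf2.toLp f x = ∫ x, 𝓕 φ x • f x :=
    integral_congr_ae (by filter_upwards [hf2.coeFn_toLp] with x hx; rw [hx])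
  have h4 : ∀ u : E → ℂ, ∫ x, g x • u x = ∫ x, φ x • u x := fun u => by
    refine integral_congr_ae (Filter.Eventually.of_forall fun x => ?_)
    simp [hφ]
  rw [h4, h4, h2, ← h3, ← h1]

/-- Plancherel's theorem on `L¹ ∩ L²`. -/
theorem lintegral_enorm_fourier_sq {f : E → ℂ} (hf : Integrable f) (hf2 : MemLp f 2) :
    ∫⁻ x, ‖𝓕 f x‖ₑ ^ (2 : ℝ) = ∫⁻ x, ‖f x‖ₑ ^ (2 : ℝ) := by
  have h := congrArg ENNReal.ofReal (Lp.norm_fourier_eq (hf2.toLp f))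
  rw [Lp.norm_def, Lp.norm_def, ENNReal.ofReal_toReal (Lp.eLpNorm_ne_top _),
    ENNReal.ofReal_toReal (Lp.eLpNorm_ne_top _), eLpNorm_congr_ae (fourier_toLp_ae_eq hf hf2),
    eLpNorm_congr_ae hf2.coeFn_toLp, eLpNorm_eq_lintegral_rpow_enorm_toReal (by norm_num) (by norm_num),
    eLpNorm_eq_lintegral_rpow_enorm_toReal (by norm_num) (by norm_num)] at h
  simp only [ENNReal.toReal_ofNat] at h
  exact (ENNReal.rpow_left_injective (by norm_num : (1 / 2 : ℝ) ≠ 0)) h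

end FourierLp

/-! ### Hausdorff–Young by real interpolation between `L¹ → L^∞` and `L² → L²`. -/

section HausdorffYoung

variable {E : Type*} [NormedAddCommGroup E] [InnerProductSpace ℝ E] [FiniteDimensional ℝ E]
  [MeasurableSpace E] [BorelSpace E]

theorem fourier_add_of_integrable {f g : E → ℂ} (hf : Integrable f) (hg : Integrable g) (w : E) :
    𝓕 (fun x => f x + g x) w = 𝓕 f w + 𝓕 g w := by
  simp only [Real.fourier_eq, smul_add]
  exact integral_add ((Real.fourierIntegral_convergent_iff w).2 hf)
    ((Real.fourierIntegral_convergent_iff w).2 hg)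

/-- Splitting `f` at height `κ` bounds the distribution function of its Fourier transform. -/
theorem volume_lt_norm_fourier_le {f : E → ℂ} (hm : Measurable f) (hf : Integrable f)
    (hf2 : MemLp f 2) {s N t κ : ℝ} (hs : 1 < s) (hN : ∫⁻ x, ‖f x‖ₑ ^ s ≤ ENNReal.ofReal N)
    (ht : 0 < t) (hκ : 0 < κ) (h : κ ^ (1 - s) * N ≤ t / 2) :
    volume {x | t < ‖𝓕 f x‖} ≤
      ENNReal.ofReal (4 / t ^ 2) * ∫⁻ x, {x | ‖f x‖ ≤ κ}.indicator (fun x => ‖f x‖ₑ ^ (2 : ℝ)) x := by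
  set S : Set E := {x | ‖f x‖ ≤ κ} with hS
  have hSm : MeasurableSet S := measurableSet_le hm.norm measurable_const
  have hsum : f = fun x => S.indicator f x + Sᶜ.indicator f x := by
    ext x; exact (congrFun (Set.indicator_self_add_compl S f) x).symm
  have hi1 := hf.indicator hSm
  have hi2 := hf.indicator hSm.compl
  -- Where `‖f‖ > κ` one has `‖f‖ ≤ κ^(1-s) ‖f‖^s`, so the large part has `L¹` norm at most `t/2`.
  -- Level `t` can then only be passed if the bounded part contributes `t/2`, which Chebyshev and
  -- Plancherel control.
  have hbig : ∀ w, ‖𝓕 (Sᶜ.indicator f) w‖ ≤ t / 2 := fun w => by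
    have h1 : ∫⁻ x, ‖Sᶜ.indicator f x‖ₑ ≤ ENNReal.ofReal (t / 2) := by
      calc ∫⁻ x, ‖Sᶜ.indicator f x‖ₑ
          ≤ ∫⁻ x, ENNReal.ofReal (κ ^ (1 - s)) * ‖f x‖ₑ ^ s := by
            refine lintegral_mono fun x => ?_
            by_cases hx : x ∈ S
            · simp [hx]
            · rw [Set.indicator_of_mem (by simpa using hx)]
              have hx' : κ < ‖f x‖ := by simpa [hS] using hx
              have hpos : 0 < ‖f x‖ := hκ.trans hx'
              rw [← ofReal_norm, ENNReal.ofReal_rpow_of_pos hpos,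
                ← ENNReal.ofReal_mul (by positivity)]
              refine ENNReal.ofReal_le_ofReal ?_
              have : ‖f x‖ ^ (1 - s) ≤ κ ^ (1 - s) :=
                Real.rpow_le_rpow_of_nonpos hκ hx'.le (by linarith)
              calc ‖f x‖ = ‖f x‖ ^ (1 - s) * ‖f x‖ ^ s := by
                    rw [← Real.rpow_add hpos]; simp
                _ ≤ _ := by gcongr
        _ = ENNReal.ofReal (κ ^ (1 - s)) * ∫⁻ x, ‖f x‖ₑ ^ s :=
            lintegral_const_mul' _ _ ENNReal.ofReal_ne_top
        _ ≤ ENNReal.ofReal (κ ^ (1 - s)) * ENNReal.ofReal N := by gcongr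
        _ ≤ ENNReal.ofReal (t / 2) := by
            rw [← ENNReal.ofReal_mul (by positivity)]
            exact ENNReal.ofReal_le_ofReal h
    have h2 := (enorm_fourier_le (Sᶜ.indicator f) w).trans h1
    rw [← ofReal_norm] at h2
    exact (ENNReal.ofReal_le_ofReal_iff (by positivity)).1 h2
  have hsub : {x | t < ‖𝓕 f x‖} ⊆
      {x | ENNReal.ofReal ((t / 2) ^ 2) ≤ ‖𝓕 (S.indicator f) x‖ₑ ^ (2 : ℝ)} := by
    intro w hw
    simp only [Set.mem_ofPred_eq] at hw ⊢
    have h3 : ‖𝓕 f w‖ ≤ ‖𝓕 (S.indicator f) w‖ + ‖𝓕 (Sᶜ.indicator f) w‖ := by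
      conv_lhs => rw [hsum, fourier_add_of_integrable hi1 hi2]
      exact norm_add_le _ _
    have h4 : t / 2 ≤ ‖𝓕 (S.indicator f) w‖ := by linarith [hbig w]
    rw [← ofReal_norm, ENNReal.ofReal_rpow_of_nonneg (norm_nonneg _) (by norm_num),
      Real.rpow_two]
    gcongr
  have hcheb := mul_meas_ge_le_lintegral₀ (μ := (volume : Measure E))
    (f := fun x => ‖𝓕 (S.indicator f) x‖ₑ ^ (2 : ℝ))
    ((continuous_fourier_of_integrable hi1).measurable.enorm.pow_const _).aemeasurable
    (ENNReal.ofReal ((t / 2) ^ 2))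
  rw [lintegral_enorm_fourier_sq hi1 (hf2.indicator hSm)] at hcheb
  have hind : ∫⁻ x, ‖S.indicator f x‖ₑ ^ (2 : ℝ)
      = ∫⁻ x, S.indicator (fun x => ‖f x‖ₑ ^ (2 : ℝ)) x := by
    refine lintegral_congr fun x => ?_
    by_cases hx : x ∈ S <;> simp [hx]
  rw [hind] at hcheb
  calc volume {x | t < ‖𝓕 f x‖} ≤ _ := measure_mono hsub
    _ = ENNReal.ofReal (4 / t ^ 2) * (ENNReal.ofReal ((t / 2) ^ 2) *
          volume {x | ENNReal.ofReal ((t / 2) ^ 2) ≤ ‖𝓕 (S.indicator f) x‖ₑ ^ (2 : ℝ)}) := by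
        rw [← mul_assoc, ← ENNReal.ofReal_mul (by positivity)]
        have : 4 / t ^ 2 * (t / 2) ^ 2 = 1 := by field_simp; norm_num
        rw [this]; simp
    _ ≤ _ := by gcongr

theorem lintegral_Ioc_rpow_le {L a : ℝ} (hL : 0 ≤ L) (ha : 0 < a) :
    ∫⁻ t in Set.Ioc 0 L, ENNReal.ofReal (t ^ (a - 1)) = ENNReal.ofReal (L ^ a / a) := by
  rw [← ofReal_integral_eq_lintegral_ofReal]
  · rw [← intervalIntegral.integral_of_le hL, integral_rpow (Or.inl (by linarith))]
    simp [Real.zero_rpow ha.ne']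
  · exact (intervalIntegrable_iff_integrableOn_Ioc_of_le hL).1
      (intervalIntegral.intervalIntegrable_rpow' (by linarith))
  · refine (ae_restrict_iff' measurableSet_Ioc).2 (Filter.Eventually.of_forall fun t ht => ?_)
    exact Real.rpow_nonneg ht.1.le _

/-- Layer-cake formula with a truncation height that varies with the level `t`; after Tonelli, the
integral in `t` at fixed `x` is an explicit power of `‖f x‖`. -/
theorem lintegral_enorm_fourier_rpow_le_of_measurable {s N : ℝ} (hs : 1 < s) (hs2 : s < 2)
    {f : E → ℂ} (hm : Measurable f) (hf : Integrable f) (hf2 : MemLp f 2) (hN0 : 0 < N)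
    (hN : ∫⁻ x, ‖f x‖ₑ ^ s = ENNReal.ofReal N) {r : ℝ} (hr : r = s / (s - 1)) :
    ∫⁻ x, ‖𝓕 f x‖ₑ ^ r ≤
      ENNReal.ofReal (r * (4 * (2 ^ (r - 2) / (r - 2))) * N ^ (r - 1)) := by
  have hs0 : 0 < s - 1 := by linarith
  have hr2 : 0 < r - 2 := by
    rw [hr, sub_pos, lt_div_iff₀ hs0]; linarith
  have hexp : (1 - s) * (r - 2) = s - 2 := by rw [hr]; field_simp; ring
  have hcont := continuous_fourier_of_integrable hf
  -- This height solves `κ^(1-s) * N = t/2`, the largest `L¹` mass allowed for the part of `f` above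
  -- it.
  set κ : ℝ → ℝ := fun t => (t / (2 * N)) ^ (1 / (1 - s)) with hκdef
  have hκ : ∀ t, 0 < t → 0 < κ t := fun t ht => by positivity
  have hκs : ∀ t, 0 < t → κ t ^ (1 - s) = t / (2 * N) := fun t ht => by
    rw [hκdef, ← Real.rpow_mul (by positivity), one_div_mul_cancel (by linarith), Real.rpow_one]
  have hlevel : ∀ t ∈ Set.Ioi (0 : ℝ),
      volume {x | t < ‖𝓕 f x‖} * ENNReal.ofReal (t ^ (r - 1)) ≤
      ∫⁻ x, ENNReal.ofReal (4 * t ^ (r - 2 - 1)) *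
        {x | ‖f x‖ ≤ κ t}.indicator (fun x => ‖f x‖ₑ ^ (2 : ℝ)) x := by
    intro t ht
    have ht' : 0 < t := ht
    rw [lintegral_const_mul' _ _ ENNReal.ofReal_ne_top]
    have := volume_lt_norm_fourier_le hm hf hf2 hs hN.le ht' (hκ t ht')
      (by rw [hκs t ht']; apply le_of_eq; field_simp)
    calc _ ≤ (ENNReal.ofReal (4 / t ^ 2) * ∫⁻ x, {x | ‖f x‖ ≤ κ t}.indicator
            (fun x => ‖f x‖ₑ ^ (2 : ℝ)) x) * ENNReal.ofReal (t ^ (r - 1)) := by gcongr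
      _ = _ := by
        rw [mul_right_comm, ← ENNReal.ofReal_mul (by positivity)]
        congr 2
        rw [div_mul_eq_mul_div, mul_div_assoc]
        congr 1
        rw [← Real.rpow_two, ← Real.rpow_sub ht']
        ring_nf
  have hpoint : ∀ x, ∫⁻ t in Set.Ioi (0 : ℝ), ENNReal.ofReal (4 * t ^ (r - 2 - 1)) *
        {x | ‖f x‖ ≤ κ t}.indicator (fun x => ‖f x‖ₑ ^ (2 : ℝ)) x ≤
      ENNReal.ofReal (4 * (2 ^ (r - 2) / (r - 2)) * N ^ (r - 2)) * ‖f x‖ₑ ^ s := by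
    intro x
    rcases eq_or_ne (f x) 0 with h0 | h0
    · have : ∀ t, {x | ‖f x‖ ≤ κ t}.indicator (fun x => ‖f x‖ₑ ^ (2 : ℝ)) x = 0 := fun t => by
        by_cases hx : x ∈ {x | ‖f x‖ ≤ κ t}
        · rw [Set.indicator_of_mem hx, h0]; simp
        · rw [Set.indicator_of_notMem hx]
      simp only [this, mul_zero, lintegral_zero, zero_le]
    have hpos : 0 < ‖f x‖ := norm_pos_iff.2 h0
    -- As `1 - s < 0`, the condition `‖f x‖ ≤ κ t` amounts to `t ≤ L`. Integrating `t^(r-3)` up to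
    -- `L` gives the power `(1-s)(r-2) = s-2` of `‖f x‖`, which turns `‖f x‖²` into `‖f x‖^s`.
    set L : ℝ := 2 * N * ‖f x‖ ^ (1 - s) with hL
    have hLpos : 0 < L := by positivity
    calc _ ≤ ∫⁻ t in Set.Ioi (0 : ℝ), (Set.Ioc 0 L).indicator
          (fun t => ENNReal.ofReal 4 * ‖f x‖ₑ ^ (2 : ℝ) * ENNReal.ofReal (t ^ (r - 2 - 1))) t := by
          refine setLIntegral_mono' measurableSet_Ioi fun t ht => ?_
          have ht' : 0 < t := ht
          by_cases hx : ‖f x‖ ≤ κ t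
          · have htL : t ∈ Set.Ioc 0 L := by
              refine ⟨ht', ?_⟩
              have := Real.rpow_le_rpow_of_nonpos hpos hx (show 1 - s ≤ 0 by linarith)
              rw [hκs t ht', div_le_iff₀ (by positivity)] at this
              rw [hL]; linarith
            rw [Set.indicator_of_mem htL, Set.indicator_of_mem (by exact hx),
              ENNReal.ofReal_mul (by norm_num)]
            apply le_of_eq; ring
          · rw [Set.indicator_of_notMem (by exact hx)]; simp
      _ ≤ ∫⁻ t, (Set.Ioc 0 L).indicator
          (fun t => ENNReal.ofReal 4 * ‖f x‖ₑ ^ (2 : ℝ) * ENNReal.ofReal (t ^ (r - 2 - 1))) t :=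
          setLIntegral_le_lintegral _ _
      _ = ENNReal.ofReal 4 * ‖f x‖ₑ ^ (2 : ℝ) * ENNReal.ofReal (L ^ (r - 2) / (r - 2)) := by
          rw [lintegral_indicator measurableSet_Ioc, lintegral_const_mul' _ _ (by finiteness),
            lintegral_Ioc_rpow_le hLpos.le hr2]
      _ = _ := by
          rw [← ofReal_norm, ENNReal.ofReal_rpow_of_pos hpos, ENNReal.ofReal_rpow_of_pos hpos,
            ← ENNReal.ofReal_mul (by positivity), ← ENNReal.ofReal_mul (by positivity),
            ← ENNReal.ofReal_mul (by positivity)]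
          congr 1
          have e1 : ‖f x‖ ^ s = ‖f x‖ ^ (2 : ℝ) * ‖f x‖ ^ ((1 - s) * (r - 2)) := by
            rw [← Real.rpow_add hpos, hexp]; ring_nf
          rw [hL, Real.mul_rpow (by positivity) (by positivity),
            Real.mul_rpow (by positivity) (by positivity), ← Real.rpow_mul hpos.le, e1]
          ring
  have hmeas : AEMeasurable (fun p : ℝ × E => ENNReal.ofReal (4 * p.1 ^ (r - 2 - 1)) *
        {x | ‖f x‖ ≤ κ p.1}.indicator (fun x => ‖f x‖ₑ ^ (2 : ℝ)) p.2)
        ((volume.restrict (Set.Ioi 0)).prod volume) := by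
    have e : ∀ p : ℝ × E, {x | ‖f x‖ ≤ κ p.1}.indicator (fun x => ‖f x‖ₑ ^ (2 : ℝ)) p.2 =
        {p : ℝ × E | ‖f p.2‖ ≤ κ p.1}.indicator (fun p => ‖f p.2‖ₑ ^ (2 : ℝ)) p := fun p => rfl
    simp_rw [e]
    refine (Measurable.mul (by fun_prop) (Measurable.indicator (by fun_prop)
      (measurableSet_le (by fun_prop) ?_))).aemeasurable
    exact (measurable_fst.div_const _).pow_const _
  calc ∫⁻ x, ‖𝓕 f x‖ₑ ^ r = ∫⁻ x, ENNReal.ofReal (‖𝓕 f x‖ ^ r) := by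
        refine lintegral_congr fun x => ?_
        rw [← ofReal_norm, ENNReal.ofReal_rpow_of_nonneg (norm_nonneg _) (by linarith)]
    _ = ENNReal.ofReal r * ∫⁻ t in Set.Ioi 0,
          volume {x | t < ‖𝓕 f x‖} * ENNReal.ofReal (t ^ (r - 1)) :=
        lintegral_rpow_eq_lintegral_meas_lt_mul volume
          (Filter.Eventually.of_forall fun x => norm_nonneg _)
          hcont.norm.measurable.aemeasurable (by linarith)
    _ ≤ ENNReal.ofReal r * ∫⁻ t in Set.Ioi 0, ∫⁻ x, ENNReal.ofReal (4 * t ^ (r - 2 - 1)) *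
        {x | ‖f x‖ ≤ κ t}.indicator (fun x => ‖f x‖ₑ ^ (2 : ℝ)) x := by
        gcongr 1
        exact setLIntegral_mono' measurableSet_Ioi hlevel
    _ = ENNReal.ofReal r * ∫⁻ x, ∫⁻ t in Set.Ioi 0, ENNReal.ofReal (4 * t ^ (r - 2 - 1)) *
        {x | ‖f x‖ ≤ κ t}.indicator (fun x => ‖f x‖ₑ ^ (2 : ℝ)) x := by
        rw [lintegral_lintegral_swap hmeas]
    _ ≤ ENNReal.ofReal r * ∫⁻ x,
        ENNReal.ofReal (4 * (2 ^ (r - 2) / (r - 2)) * N ^ (r - 2)) * ‖f x‖ₑ ^ s := by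
        gcongr 1
        exact lintegral_mono hpoint
    _ = _ := by
        rw [lintegral_const_mul' _ _ ENNReal.ofReal_ne_top, hN,
          ← ENNReal.ofReal_mul (by positivity), ← ENNReal.ofReal_mul (by linarith)]
        congr 1
        have : N ^ (r - 1) = N ^ (r - 2) * N := by
          rw [← Real.rpow_add_one hN0.ne']; ring_nf
        rw [this]; ring

/-- The Hausdorff–Young inequality, with an unspecified constant. -/
theorem lintegral_enorm_fourier_rpow_le {s r : ℝ} (hs : 1 < s) (hs2 : s < 2)
    (hr : r = s / (s - 1)) :
    ∃ C : ℝ≥0, ∀ f : E → ℂ, Integrable f → MemLp f 2 →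
      ∫⁻ x, ‖𝓕 f x‖ₑ ^ r ≤ C * (∫⁻ x, ‖f x‖ₑ ^ s) ^ (r - 1) := by
  have hs0 : 0 < s - 1 := by linarith
  have hr2 : 2 < r := by
    rw [hr, lt_div_iff₀ hs0]; linarith
  have hc : 0 < r * (4 * (2 ^ (r - 2) / (r - 2))) := by
    have : 0 < r - 2 := by linarith
    positivity
  refine ⟨(r * (4 * (2 ^ (r - 2) / (r - 2)))).toNNReal, fun f hf hf2 => ?_⟩
  set g := hf.1.mk f with hg
  have hfg : f =ᵐ[volume] g := hf.1.ae_eq_mk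
  have h1 : 𝓕 f = 𝓕 g := funext fun w => Real.fourier_congr_ae hfg w
  have h2 : ∫⁻ x, ‖f x‖ₑ ^ s = ∫⁻ x, ‖g x‖ₑ ^ s :=
    lintegral_congr_ae (by filter_upwards [hfg] with x hx; rw [hx])
  rw [h1, h2]
  have hgm : Measurable g := hf.1.stronglyMeasurable_mk.measurable
  rcases eq_or_ne (∫⁻ x, ‖g x‖ₑ ^ s) 0 with h0 | h0
  · have hz : g =ᵐ[volume] fun _ => (0 : ℂ) := by
      have := (lintegral_eq_zero_iff (hgm.enorm.pow_const s)).1 h0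
      filter_upwards [this] with x hx
      simpa [ENNReal.rpow_eq_zero_iff, (by linarith : 0 < s), (by linarith : ¬ s < 0)] using hx
    have : ∀ w, 𝓕 g w = 0 := fun w => by
      rw [Real.fourier_congr_ae hz w, Real.fourier_eq]; simp
    simp [this, (by linarith : 0 < r)]
  rcases eq_or_ne (∫⁻ x, ‖g x‖ₑ ^ s) ∞ with htop | htop
  · rw [htop, ENNReal.top_rpow_of_pos (by linarith), ENNReal.mul_top]
    · exact le_top
    · simpa using hc
  have hN := (ENNReal.ofReal_toReal htop).symm
  have hN0 : 0 < (∫⁻ x, ‖g x‖ₑ ^ s).toReal := ENNReal.toReal_pos h0 htop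
  refine (lintegral_enorm_fourier_rpow_le_of_measurable hs hs2 hgm (hf.congr hfg)
    (hf2.ae_eq hfg) hN0 hN hr).trans (le_of_eq ?_)
  rw [ENNReal.ofReal_mul hc.le, ← ENNReal.ofReal_rpow_of_pos hN0, ENNReal.ofReal_toReal htop]
  rfl

end HausdorffYoung

/-! ### Hardy–Littlewood–Sobolev on the line. -/

section FractionalIntegration

theorem lintegral_comp_abs (g : ℝ → ℝ≥0∞) :
    ∫⁻ z, g |z| = 2 * ∫⁻ t in Set.Ioi 0, g t := by
  have h1 : ∫⁻ z in Set.Ioi 0, g |z| = ∫⁻ t in Set.Ioi 0, g t :=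
    setLIntegral_congr_fun measurableSet_Ioi fun t ht => by rw [abs_of_pos ht]
  have h2 : ∫⁻ z in Set.Iio 0, g |z| = ∫⁻ t in Set.Ioi 0, g t := by
    rw [← h1]
    have := (Measure.measurePreserving_neg (volume : Measure ℝ)).setLIntegral_comp_preimage_emb
      (MeasurableEquiv.neg ℝ).measurableEmbedding (fun z => g |z|) (Set.Iio 0)
    simp only [abs_neg] at this
    rw [← this]
    congr 2
    ext t; simp
  rw [← lintegral_add_compl _ (measurableSet_Ioi (a := (0 : ℝ))), Set.compl_Ioi,
    setLIntegral_congr (Iio_ae_eq_Iic (a := (0 : ℝ))).symm, h1, h2, two_mul]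

/-- The part of the Riesz kernel inside a ball. -/
theorem lintegral_abs_le_rpow {lam R : ℝ} (h1 : lam < 1) (hR : 0 < R) (x : ℝ) :
    ∫⁻ y, {y | |x - y| ≤ R}.indicator (fun y => ENNReal.ofReal (|x - y| ^ (-lam))) y =
      ENNReal.ofReal (2 / (1 - lam) * R ^ (1 - lam)) := by
  have e : ∀ y, {y | |x - y| ≤ R}.indicator (fun y => ENNReal.ofReal (|x - y| ^ (-lam))) y =
      (Set.Iic R).indicator (fun t => ENNReal.ofReal (t ^ (-lam))) |x - y| := fun y => rfl
  simp_rw [e]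
  rw [lintegral_sub_left_eq_self
    (fun z : ℝ => (Set.Iic R).indicator (fun t => ENNReal.ofReal (t ^ (-lam))) |z|) x,
    lintegral_comp_abs, setLIntegral_indicator measurableSet_Iic]
  have : Set.Iic R ∩ Set.Ioi 0 = Set.Ioc 0 R := by ext; simp [and_comm]
  rw [this]
  have h := lintegral_Ioc_rpow_le hR.le (show 0 < 1 - lam by linarith)
  simp only [sub_sub_cancel_left] at h
  rw [h, show (2 : ℝ≥0∞) = ENNReal.ofReal 2 by simp, ← ENNReal.ofReal_mul (by norm_num)]
  congr 1; ring

/-- The exponent `-2` is what the kernel `|x - y|^(-lam)` acquires when raised to `2/lam`, the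
conjugate of the exponent `2/(2 - lam)`. -/
theorem lintegral_lt_abs_rpow_neg_two {R : ℝ} (hR : 0 < R) (x : ℝ) :
    ∫⁻ y, {y | R < |x - y|}.indicator (fun y => ENNReal.ofReal (|x - y| ^ (-2 : ℝ))) y =
      ENNReal.ofReal (2 / R) := by
  have e : ∀ y, {y | R < |x - y|}.indicator (fun y => ENNReal.ofReal (|x - y| ^ (-2 : ℝ))) y =
      (Set.Ioi R).indicator (fun t => ENNReal.ofReal (t ^ (-2 : ℝ))) |x - y| := fun y => rfl
  simp_rw [e]
  rw [lintegral_sub_left_eq_self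
    (fun z : ℝ => (Set.Ioi R).indicator (fun t => ENNReal.ofReal (t ^ (-2 : ℝ))) |z|) x,
    lintegral_comp_abs, setLIntegral_indicator measurableSet_Ioi,
    Set.inter_eq_left.2 (Set.Ioi_subset_Ioi hR.le), ← ofReal_integral_eq_lintegral_ofReal
      (integrableOn_Ioi_rpow_of_lt (by norm_num) hR)
      ((ae_restrict_iff' measurableSet_Ioi).2 (Filter.Eventually.of_forall fun t ht =>
        Real.rpow_nonneg (hR.trans ht).le _)),
    integral_Ioi_rpow_of_lt (by norm_num) hR, show (2 : ℝ≥0∞) = ENNReal.ofReal 2 by simp,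
    ← ENNReal.ofReal_mul (by norm_num)]
  congr 1
  norm_num [Real.rpow_neg_one]
  rfl

/-- Pointwise bound for the fractional integral of a truncated function. -/
theorem lintegral_min_mul_rpow_le {lam : ℝ} (h0 : 0 < lam) (h1 : lam < 1) {f : ℝ → ℝ≥0}
    (hf : Measurable f) {N : ℝ} (hN0 : 0 < N)
    (hN : ∫⁻ x, (f x : ℝ≥0∞) ^ (2 / (2 - lam)) = ENNReal.ofReal N) {A : ℝ} (hA : 0 < A) (x : ℝ) :
    ∫⁻ y, min (f y : ℝ≥0∞) (ENNReal.ofReal A) * ENNReal.ofReal (|x - y| ^ (-lam)) ≤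
      ENNReal.ofReal ((2 / (1 - lam) + 2 ^ (lam / 2)) * N ^ (1 - lam) *
        A ^ (2 / (2 - lam) - 1)) := by
  set α : ℝ := 2 / (2 - lam) with hα
  have hl2 : 0 < 2 - lam := by linarith
  have hα0 : 0 < α := by positivity
  -- Near the diagonal the truncated function is bounded by `A`; far from it Hölder is used. This
  -- radius makes both contributions a multiple of `N^(1-lam) * A^(α-1)`.
  set R : ℝ := N * A ^ (-α) with hR
  have hR0 : 0 < R := by positivity
  have hconj : α.HolderConjugate (2 / lam) := by
    rw [Real.holderConjugate_iff]
    refine ⟨by rw [hα, lt_div_iff₀ hl2]; linarith, ?_⟩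
    rw [hα]; field_simp; ring
  set far : ℝ → ℝ≥0∞ := {y | R < |x - y|}.indicator (fun y => ENNReal.ofReal (|x - y| ^ (-lam)))
    with hfar
  have hfarm : Measurable far :=
    Measurable.indicator (by fun_prop) (measurableSet_lt (by fun_prop) (by fun_prop))
  have hsplit : ∀ y, min (f y : ℝ≥0∞) (ENNReal.ofReal A) * ENNReal.ofReal (|x - y| ^ (-lam)) ≤
      ENNReal.ofReal A * {y | |x - y| ≤ R}.indicator
        (fun y => ENNReal.ofReal (|x - y| ^ (-lam))) y + f y * far y := by
    intro y
    by_cases hy : |x - y| ≤ R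
    · rw [Set.indicator_of_mem (by exact hy)]
      exact le_add_right (mul_le_mul_left (min_le_right _ _) _)
    · rw [hfar, Set.indicator_of_mem (s := {y | R < |x - y|}) (by exact not_le.1 hy)]
      exact le_add_left (mul_le_mul_left (min_le_left _ _) _)
  have hfarint : ∫⁻ y, far y ^ (2 / lam) = ENNReal.ofReal (2 / R) := by
    rw [← lintegral_lt_abs_rpow_neg_two hR0 x]
    refine lintegral_congr fun y => ?_
    by_cases hy : R < |x - y|
    · rw [hfar, Set.indicator_of_mem (by exact hy), Set.indicator_of_mem (by exact hy),
        ENNReal.ofReal_rpow_of_nonneg (by positivity) (by positivity), ← Real.rpow_mul (by positivity)]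
      congr 2; field_simp
    · rw [hfar, Set.indicator_of_notMem (by exact hy), Set.indicator_of_notMem (by exact hy),
        ENNReal.zero_rpow_of_pos (by positivity)]
  have hHold := ENNReal.lintegral_mul_le_Lp_mul_Lq volume hconj
    (f := fun y => (f y : ℝ≥0∞)) (g := far) (by fun_prop) hfarm.aemeasurable
  rw [hN, hfarint, ENNReal.ofReal_rpow_of_pos hN0, ENNReal.ofReal_rpow_of_pos (by positivity),
    ← ENNReal.ofReal_mul (by positivity)] at hHold
  have e1 : A * R ^ (1 - lam) = N ^ (1 - lam) * A ^ (α - 1) := by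
    rw [hR, Real.mul_rpow hN0.le (by positivity), ← Real.rpow_mul hA.le]
    have : α - 1 = 1 + -α * (1 - lam) := by rw [hα]; field_simp; ring
    rw [this, Real.rpow_add hA, Real.rpow_one]; ring
  have e2 : N ^ (1 / α) * (2 / R) ^ (1 / (2 / lam)) = 2 ^ (lam / 2) * (N ^ (1 - lam) * A ^ (α - 1)) := by
    have i1 : 1 / (2 / lam) = lam / 2 := by field_simp
    have i2 : α - 1 = α * (lam / 2) := by rw [hα]; field_simp; ring
    have i3 : 1 / α = (1 - lam) + lam / 2 := by rw [hα]; field_simp; ring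
    have i4 : 2 / R = 2 * (N⁻¹ * A ^ α) := by
      rw [hR, Real.rpow_neg hA.le]; field_simp
    rw [i1, i4, Real.mul_rpow (by norm_num) (by positivity),
      Real.mul_rpow (by positivity) (by positivity), ← Real.rpow_mul hA.le, ← i2, i3,
      Real.rpow_add hN0, Real.inv_rpow hN0.le]
    field_simp
  calc _ ≤ ∫⁻ y, (ENNReal.ofReal A * {y | |x - y| ≤ R}.indicator
        (fun y => ENNReal.ofReal (|x - y| ^ (-lam))) y + f y * far y) := lintegral_mono hsplit
    _ = ENNReal.ofReal A * ENNReal.ofReal (2 / (1 - lam) * R ^ (1 - lam)) +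
        ∫⁻ y, f y * far y := by
      rw [lintegral_add_right _ (by fun_prop), lintegral_const_mul' _ _ ENNReal.ofReal_ne_top,
        lintegral_abs_le_rpow h1 hR0]
    _ ≤ ENNReal.ofReal A * ENNReal.ofReal (2 / (1 - lam) * R ^ (1 - lam)) +
        ENNReal.ofReal (N ^ (1 / α) * (2 / R) ^ (1 / (2 / lam))) := by gcongr; exact hHold
    _ = _ := by
      have : 0 < 1 - lam := by linarith
      rw [← ENNReal.ofReal_mul hA.le, ← ENNReal.ofReal_add (by positivity) (by positivity)]
      congr 1
      rw [e2]
      calc _ = 2 / (1 - lam) * (A * R ^ (1 - lam)) +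
            2 ^ (lam / 2) * (N ^ (1 - lam) * A ^ (α - 1)) := by ring
        _ = _ := by rw [e1]; ring

/-- The diagonal Hardy–Littlewood–Sobolev inequality on the line. -/
theorem lintegral_mul_mul_rpow_le {lam : ℝ} (h0 : 0 < lam) (h1 : lam < 1) :
    ∃ C : ℝ≥0, ∀ f : ℝ → ℝ≥0, Measurable f →
      ∫⁻ x, ∫⁻ y, f x * f y * ENNReal.ofReal (|x - y| ^ (-lam)) ≤
        C * (∫⁻ x, (f x : ℝ≥0∞) ^ (2 / (2 - lam))) ^ (2 - lam) := by
  set c : ℝ := 2 / (1 - lam) + 2 ^ (lam / 2) with hc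
  have hc0 : 0 < c := by
    have : 0 < 1 - lam := by linarith
    positivity
  refine ⟨2 * c.toNNReal, fun f hf => ?_⟩
  set α : ℝ := 2 / (2 - lam) with hα
  have hα1 : 1 < α := by
    rw [hα, lt_div_iff₀ (by linarith)]; linarith
  set K : ℝ → ℝ → ℝ≥0∞ := fun x y => ENNReal.ofReal (|x - y| ^ (-lam)) with hK
  rcases eq_or_ne (∫⁻ x, (f x : ℝ≥0∞) ^ α) 0 with hz | hz
  · have : ∀ᵐ x, f x = 0 := by
      have := (lintegral_eq_zero_iff (hf.coe_nnreal_ennreal.pow_const α)).1 hz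
      filter_upwards [this] with x hx
      simpa [ENNReal.rpow_eq_zero_iff, (by linarith : 0 < α), (by linarith : ¬ α < 0)] using hx
    refine le_of_eq_of_le ?_ zero_le
    rw [lintegral_eq_zero_iff' (by fun_prop)]
    filter_upwards [this] with x hx
    simp [hx]
  rcases eq_or_ne (∫⁻ x, (f x : ℝ≥0∞) ^ α) ∞ with htop | htop
  · rw [htop, ENNReal.top_rpow_of_pos (by linarith), ENNReal.mul_top]
    · exact le_top
    · simpa using hc0
  set N := (∫⁻ x, (f x : ℝ≥0∞) ^ α).toReal with hNdef
  have hN : ∫⁻ x, (f x : ℝ≥0∞) ^ α = ENNReal.ofReal N := (ENNReal.ofReal_toReal htop).symm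
  have hN0 : 0 < N := ENNReal.toReal_pos hz htop
  -- A product is the larger factor times the smaller. Truncating the smaller at the value of the
  -- larger lets the pointwise bound apply with `A = f x`, and `f x * (f x)^(α-1) = (f x)^α` closes
  -- the estimate without further interpolation.
  have hpt : ∀ x y, f x * f y * K x y ≤ f x * (min (f y : ℝ≥0∞) (f x) * K x y) +
      f y * (min (f x : ℝ≥0∞) (f y) * K y x) := by
    intro x y
    have hsymm : K y x = K x y := by simp only [hK, abs_sub_comm]
    rw [hsymm]
    rcases le_total (f x : ℝ≥0∞) (f y) with h | h
    · rw [min_eq_left h]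
      refine le_add_left (le_of_eq (by ring))
    · rw [min_eq_left h]
      refine le_add_right (le_of_eq (by ring))
  have hone : ∀ x, f x * ∫⁻ y, min (f y : ℝ≥0∞) (f x) * K x y ≤
      ENNReal.ofReal (c * N ^ (1 - lam)) * (f x : ℝ≥0∞) ^ α := by
    intro x
    rcases eq_or_ne (f x) 0 with hx | hx
    · simp [hx]
    have hpos : (0 : ℝ) < f x := by positivity
    have := lintegral_min_mul_rpow_le h0 h1 hf hN0 hN hpos x
    rw [ENNReal.ofReal_coe_nnreal] at this
    calc _ ≤ (f x : ℝ≥0∞) * ENNReal.ofReal (c * N ^ (1 - lam) * (f x : ℝ) ^ (α - 1)) := by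
          gcongr
      _ = _ := by
          rw [← ENNReal.ofReal_coe_nnreal, ENNReal.ofReal_rpow_of_pos hpos,
            ← ENNReal.ofReal_mul hpos.le, ← ENNReal.ofReal_mul (by positivity)]
          congr 1
          rw [Real.rpow_sub_one hpos.ne']; field_simp
  have hm : Measurable fun p : ℝ × ℝ => (f p.1 : ℝ≥0∞) * (min (f p.2 : ℝ≥0∞) (f p.1) * K p.1 p.2) := by
    fun_prop
  have hswap : ∫⁻ x, ∫⁻ y, f y * (min (f x : ℝ≥0∞) (f y) * K y x) =
      ∫⁻ x, ∫⁻ y, f x * (min (f y : ℝ≥0∞) (f x) * K x y) :=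
    lintegral_lintegral_swap (f := fun x y => (f y : ℝ≥0∞) * (min (f x : ℝ≥0∞) (f y) * K y x))
      (by exact (hm.comp measurable_swap).aemeasurable)
  calc ∫⁻ x, ∫⁻ y, f x * f y * K x y
      ≤ ∫⁻ x, ((∫⁻ y, f x * (min (f y : ℝ≥0∞) (f x) * K x y)) +
          ∫⁻ y, f y * (min (f x : ℝ≥0∞) (f y) * K y x)) := by
        refine lintegral_mono fun x => (lintegral_mono (hpt x)).trans (le_of_eq ?_)
        exact lintegral_add_left (by fun_prop) _
    _ = 2 * ∫⁻ x, ∫⁻ y, f x * (min (f y : ℝ≥0∞) (f x) * K x y) := by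
        rw [lintegral_add_left hm.lintegral_prod_right', hswap, two_mul]
    _ ≤ 2 * ∫⁻ x, ENNReal.ofReal (c * N ^ (1 - lam)) * (f x : ℝ≥0∞) ^ α := by
        gcongr with x
        rw [lintegral_const_mul' _ _ ENNReal.coe_ne_top]
        exact hone x
    _ = _ := by
        rw [lintegral_const_mul' _ _ ENNReal.ofReal_ne_top, hN, ENNReal.ofReal_mul hc0.le,
          ENNReal.ofReal_rpow_of_pos hN0, mul_assoc, ← ENNReal.ofReal_mul (by positivity),
          ← mul_assoc]
        have : 2 - lam = 1 - lam + 1 := by ring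
        rw [this, Real.rpow_add_one hN0.ne']
        push_cast
        rfl

end FractionalIntegration

/-! ### The change of variables `(x, y) ↦ γ(x) + γ(y)`. -/

section CircleSums

/-- The unit-speed parametrization of the unit circle. -/
noncomputable def circlePoint (θ : ℝ) : Plane := !₂[Real.cos θ, Real.sin θ]

theorem continuous_circlePoint : Continuous circlePoint := by
  unfold circlePoint
  fun_prop

@[fun_prop]
theorem measurable_circlePoint : Measurable circlePoint := continuous_circlePoint.measurable

/-- Coordinates of the sum of two points of the circle. -/
noncomputable def circleSum (p : ℝ × ℝ) : ℝ × ℝ :=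
  (Real.cos p.1 + Real.cos p.2, Real.sin p.1 + Real.sin p.2)

theorem toPlane_measurePreserving :
    MeasurePreserving (fun p : ℝ × ℝ => (!₂[p.1, p.2] : Plane)) :=
  (PiLp.volume_preserving_toLp (Fin 2)).comp (volume_preserving_finTwoArrow ℝ).symm

theorem toPlane_measurableEmbedding :
    MeasurableEmbedding (fun p : ℝ × ℝ => (!₂[p.1, p.2] : Plane)) :=
  (MeasurableEquiv.toLp 2 (Fin 2 → ℝ)).measurableEmbedding.comp
    (MeasurableEquiv.finTwoArrow (α := ℝ)).symm.measurableEmbedding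

theorem circlePoint_add (p : ℝ × ℝ) :
    circlePoint p.1 + circlePoint p.2 = !₂[(circleSum p).1, (circleSum p).2] := by
  ext i
  fin_cases i <;> simp [circlePoint, circleSum]

theorem hasFDerivAt_circleSum (p : ℝ × ℝ) :
    HasFDerivAt circleSum ((Matrix.toLin (.finTwoProd ℝ) (.finTwoProd ℝ)
      !![-Real.sin p.1, -Real.sin p.2; Real.cos p.1, Real.cos p.2]).toContinuousLinearMap) p := by
  rw [Matrix.toLin_finTwoProd_toContinuousLinearMap]
  exact HasFDerivAt.prodMk (𝕜 := ℝ)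
      (((Real.hasDerivAt_cos p.1).comp_hasFDerivAt p hasFDerivAt_fst).add
        ((Real.hasDerivAt_cos p.2).comp_hasFDerivAt p hasFDerivAt_snd))
      (((Real.hasDerivAt_sin p.1).comp_hasFDerivAt p hasFDerivAt_fst).add
        ((Real.hasDerivAt_sin p.2).comp_hasFDerivAt p hasFDerivAt_snd))

/-- Ordered pairs of parameters in an arc. -/
def orderedPairs (a b : ℝ) : Set (ℝ × ℝ) := {p | a < p.1 ∧ p.1 < p.2 ∧ p.2 < b}

theorem measurableSet_orderedPairs (a b : ℝ) : MeasurableSet (orderedPairs a b) :=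
  (measurableSet_lt measurable_const measurable_fst).inter
    ((measurableSet_lt measurable_fst measurable_snd).inter
      (measurableSet_lt measurable_snd measurable_const))

/-- With `u` the half sum and `v` the half difference, the sum of the two points is `2 cos v (cos u,
sin u)`. Its length determines `v ∈ (0, 1/2)`, its direction then determines `u` modulo `2π`, and
the arc is too short for any ambiguity. -/
theorem injOn_circleSum {a b : ℝ} (hab : b - a ≤ 1) :
    Set.InjOn circleSum (orderedPairs a b) := by
  rintro ⟨x, y⟩ ⟨hx, hxy, hy⟩ ⟨z, w⟩ ⟨hz, hzw, hw⟩ h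
  simp only at hx hxy hy hz hzw hw
  have hpi := Real.pi_gt_three
  simp only [circleSum, Prod.mk.injEq] at h
  obtain ⟨h1, h2⟩ := h
  set u := (x + y) / 2 with hu
  set v := (y - x) / 2 with hv
  set u' := (z + w) / 2 with hu'
  set v' := (w - z) / 2 with hv'
  have ex : x = u - v := by rw [hu, hv]; ring
  have ey : y = u + v := by rw [hu, hv]; ring
  have ez : z = u' - v' := by rw [hu', hv']; ring
  have ew : w = u' + v' := by rw [hu', hv']; ring
  rw [ex, ey, ez, ew, Real.cos_sub, Real.cos_add, Real.cos_sub, Real.cos_add] at h1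
  rw [ex, ey, ez, ew, Real.sin_sub, Real.sin_add, Real.sin_sub, Real.sin_add] at h2
  have c1 : Real.cos u * Real.cos v = Real.cos u' * Real.cos v' := by linarith
  have c2 : Real.sin u * Real.cos v = Real.sin u' * Real.cos v' := by linarith
  have hvpos : 0 < Real.cos v := Real.cos_pos_of_mem_Ioo ⟨by linarith, by linarith⟩
  have hvpos' : 0 < Real.cos v' := Real.cos_pos_of_mem_Ioo ⟨by linarith, by linarith⟩
  have hsq : Real.cos v ^ 2 = Real.cos v' ^ 2 := by
    calc Real.cos v ^ 2 = (Real.sin u ^ 2 + Real.cos u ^ 2) * Real.cos v ^ 2 := by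
          rw [Real.sin_sq_add_cos_sq, one_mul]
      _ = (Real.sin u * Real.cos v) ^ 2 + (Real.cos u * Real.cos v) ^ 2 := by ring
      _ = (Real.sin u' ^ 2 + Real.cos u' ^ 2) * Real.cos v' ^ 2 := by rw [c1, c2]; ring
      _ = _ := by rw [Real.sin_sq_add_cos_sq, one_mul]
  have hcos : Real.cos v = Real.cos v' := (pow_left_inj₀ hvpos.le hvpos'.le two_ne_zero).1 hsq
  have hvv : v = v' := Real.injOn_cos ⟨by linarith, by linarith⟩ ⟨by linarith, by linarith⟩ hcos
  rw [hcos] at c1 c2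
  have d1 := mul_right_cancel₀ hvpos'.ne' c1
  have d2 := mul_right_cancel₀ hvpos'.ne' c2
  have hone : Real.cos (u - u') = 1 := by
    rw [Real.cos_sub, d1, d2, ← Real.sin_sq_add_cos_sq u']; ring
  have huu := (Real.cos_eq_one_iff_of_lt_of_lt (by linarith) (by linarith)).1 hone
  ext
  · simp only; linarith
  · simp only; linarith

/-- Change of variables for sums of two points of a short arc. -/
theorem lintegral_circlePoint_add_le {a b : ℝ} (hab : b - a ≤ 1) (H : Plane → ℝ≥0∞) :
    ∫⁻ p in orderedPairs a b,
      ENNReal.ofReal |Real.sin (p.2 - p.1)| * H (circlePoint p.1 + circlePoint p.2) ≤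
      ∫⁻ z, H z := by
  have h := lintegral_image_eq_lintegral_abs_det_fderiv_mul volume
    (measurableSet_orderedPairs a b) (fun p _ => (hasFDerivAt_circleSum p).hasFDerivWithinAt)
    (injOn_circleSum hab) (fun p => H !₂[p.1, p.2])
  rw [← toPlane_measurePreserving.lintegral_comp_emb toPlane_measurableEmbedding]
  calc _ = ∫⁻ p in circleSum '' orderedPairs a b, H !₂[p.1, p.2] := by
        rw [h]
        refine lintegral_congr fun p => ?_
        rw [circlePoint_add]
        congr 3
        simp only [LinearMap.det_toContinuousLinearMap, LinearMap.det_toLin,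
          Matrix.det_fin_two_of, Real.sin_sub]
        ring
    _ ≤ _ := setLIntegral_le_lintegral _ _

end CircleSums

/-! ### The bilinear estimate on a short arc. -/

section BilinearArc

theorem volume_diagonal_eq_zero : volume {p : ℝ × ℝ | p.1 = p.2} = 0 := by
  rw [Measure.volume_eq_prod,
    Measure.measure_prod_null (measurableSet_eq_fun measurable_fst measurable_snd)]
  refine Filter.Eventually.of_forall fun x => ?_
  have : Prod.mk x ⁻¹' {p : ℝ × ℝ | p.1 = p.2} = {x} := by ext y; simp [eq_comm]
  simp [this]

theorem setLIntegral_prod_self_le_two_mul {a b : ℝ} {W : ℝ × ℝ → ℝ≥0∞}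
    (hsymm : ∀ p, W p.swap = W p) :
    ∫⁻ p in Set.Ioo a b ×ˢ Set.Ioo a b, W p ≤ 2 * ∫⁻ p in orderedPairs a b, W p := by
  have hswap : ∫⁻ p in Prod.swap ⁻¹' orderedPairs a b, W p = ∫⁻ p in orderedPairs a b, W p := by
    have := (Measure.measurePreserving_swap (μ := (volume : Measure ℝ))
      (ν := (volume : Measure ℝ))).setLIntegral_comp_preimage_emb
      MeasurableEquiv.prodComm.measurableEmbedding W (orderedPairs a b)
    simp only [hsymm] at this
    exact this
  have hsub : Set.Ioo a b ×ˢ Set.Ioo a b ⊆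
      (orderedPairs a b ∪ Prod.swap ⁻¹' orderedPairs a b) ∪ {p : ℝ × ℝ | p.1 = p.2} := by
    rintro ⟨x, y⟩ ⟨⟨h1, h2⟩, ⟨h3, h4⟩⟩
    simp only at h1 h2 h3 h4
    rcases lt_trichotomy x y with h | h | h
    · exact Or.inl (Or.inl ⟨h1, h, h4⟩)
    · exact Or.inr h
    · exact Or.inl (Or.inr ⟨h3, h, h2⟩)
  calc _ ≤ ∫⁻ p in (orderedPairs a b ∪ Prod.swap ⁻¹' orderedPairs a b) ∪
          {p : ℝ × ℝ | p.1 = p.2}, W p := lintegral_mono_set hsub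
    _ ≤ ((∫⁻ p in orderedPairs a b, W p) + ∫⁻ p in Prod.swap ⁻¹' orderedPairs a b, W p) +
          ∫⁻ p in {p : ℝ × ℝ | p.1 = p.2}, W p :=
        (lintegral_union_le _ _ _).trans (by gcongr; exact lintegral_union_le _ _ _)
    _ = _ := by rw [hswap, setLIntegral_measure_zero _ _ volume_diagonal_eq_zero, add_zero, two_mul]

/-- Inserts a power of the Jacobian at the cost of a Riesz kernel. Jordan's inequality `sin t ≥
2t/π` and `π ≤ 4` give `sin t ≥ t/2`, whence the constant `2`. -/
theorem one_le_rpow_mul_sin_rpow {x y r : ℝ} (hr : 0 < r) (hxy : x < y) (hy : y - x ≤ 1) :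
    1 ≤ ENNReal.ofReal (2 ^ (1 / r) * |x - y| ^ (-(1 / r))) *
      ENNReal.ofReal |Real.sin (y - x)| ^ (1 / r) := by
  have hpos : 0 < y - x := by linarith
  have hpi := Real.pi_gt_three
  have hsin : (y - x) / 2 ≤ |Real.sin (y - x)| := by
    refine le_trans ?_ ((Real.mul_le_sin hpos.le (by linarith)).trans (le_abs_self _))
    rw [div_mul_eq_mul_div, div_le_div_iff₀ (by norm_num) Real.pi_pos]
    nlinarith [Real.pi_le_four]
  have hsin0 : 0 < |Real.sin (y - x)| := lt_of_lt_of_le (by linarith) hsin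
  rw [abs_sub_comm x y, abs_of_pos hpos, ENNReal.ofReal_rpow_of_pos hsin0,
    ← ENNReal.ofReal_mul (by positivity), ← ENNReal.ofReal_one]
  refine ENNReal.ofReal_le_ofReal ?_
  rw [Real.rpow_neg hpos.le, ← Real.inv_rpow hpos.le, ← Real.mul_rpow (by norm_num) (by positivity),
    ← Real.mul_rpow (by positivity) hsin0.le]
  refine Real.one_le_rpow ?_ (by positivity)
  calc (1 : ℝ) = 2 * (y - x)⁻¹ * ((y - x) / 2) := by field_simp
    _ ≤ _ := by gcongr

/-- The Carleson–Sjölin type bilinear estimate on a short arc. -/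
theorem lintegral_arc_mul_mul_le {r : ℝ} (hr : 2 < r) :
    ∃ C : ℝ≥0, ∀ a b : ℝ, b - a ≤ 1 → ∀ h : ℝ → ℝ≥0, Measurable h →
      ∀ H : Plane → ℝ≥0∞, Measurable H →
      ∫⁻ x in Set.Ioo a b, ∫⁻ y in Set.Ioo a b,
          h x * h y * H (circlePoint x + circlePoint y) ≤
        C * (∫⁻ x in Set.Ioo a b, (h x : ℝ≥0∞) ^ (2 * r / (2 * r - 3))) ^ ((2 * r - 3) / r) *
          (∫⁻ z, H z ^ r) ^ (1 / r) := by
  -- Here `s` is conjugate to `r`, and the kernel `|x - y|^(-1/r)` raised to `s` has exponent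
  -- `-lam`. The requirement `lam < 1` of Hardy–Littlewood–Sobolev is exactly `r > 2`.
  set lam : ℝ := 1 / (r - 1) with hlam
  set s : ℝ := r / (r - 1) with hs
  have hr1 : 0 < r - 1 := by linarith
  have hl0 : 0 < lam := by positivity
  have hl1 : lam < 1 := by rw [hlam, div_lt_one hr1]; linarith
  have hs0 : 0 < s := by positivity
  have hconj : s.HolderConjugate r := by
    rw [Real.holderConjugate_iff]
    refine ⟨by rw [hs, lt_div_iff₀ hr1]; linarith, ?_⟩
    rw [hs]; field_simp; ring
  obtain ⟨C₀, hC₀⟩ := lintegral_mul_mul_rpow_le hl0 hl1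
  set c : ℝ≥0∞ := ENNReal.ofReal (2 ^ (1 / r)) with hc
  refine ⟨(2 * (c * (C₀ : ℝ≥0∞) ^ (1 / s))).toNNReal, fun a b hab h hh H hH => ?_⟩
  have hctop : 2 * (c * (C₀ : ℝ≥0∞) ^ (1 / s)) ≠ ∞ := by
    refine ENNReal.mul_ne_top (by norm_num) (ENNReal.mul_ne_top ENNReal.ofReal_ne_top ?_)
    exact ENNReal.rpow_ne_top_of_nonneg (by positivity) ENNReal.coe_ne_top
  rw [ENNReal.coe_toNNReal hctop]
  set W : ℝ × ℝ → ℝ≥0∞ := fun p => h p.1 * h p.2 * H (circlePoint p.1 + circlePoint p.2) with hW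
  have hWm : Measurable W := by fun_prop
  have hprod : ∫⁻ x in Set.Ioo a b, ∫⁻ y in Set.Ioo a b,
      h x * h y * H (circlePoint x + circlePoint y) = ∫⁻ p in Set.Ioo a b ×ˢ Set.Ioo a b, W p := by
    rw [Measure.volume_eq_prod, ← Measure.prod_restrict, lintegral_prod _ hWm.aemeasurable]
  set g : ℝ → ℝ≥0 := (Set.Ioo a b).indicator fun x => h x ^ s with hg
  have hgm : Measurable g := (hh.pow_const s).indicator measurableSet_Ioo
  have hgint : ∫⁻ x, (g x : ℝ≥0∞) ^ (2 / (2 - lam)) =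
      ∫⁻ x in Set.Ioo a b, (h x : ℝ≥0∞) ^ (2 * r / (2 * r - 3)) := by
    rw [← lintegral_indicator measurableSet_Ioo]
    have h23 : 0 < 2 * r - 3 := by linarith
    have h2l : 2 - lam = (2 * r - 3) / (r - 1) := by rw [hlam]; field_simp; ring
    refine lintegral_congr fun x => ?_
    by_cases hx : x ∈ Set.Ioo a b
    · rw [hg, Set.indicator_of_mem hx, Set.indicator_of_mem hx, ENNReal.coe_rpow_of_nonneg _ hs0.le,
        ← ENNReal.rpow_mul, h2l, hs]
      congr 1
      field_simp
    · rw [hg, Set.indicator_of_notMem hx, Set.indicator_of_notMem hx, ENNReal.coe_zero,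
        ENNReal.zero_rpow_of_pos (by rw [h2l]; positivity)]
  -- Hölder in `(s, r)`: `v^r` is the Jacobian times `H^r`, ready for the change of variables, and
  -- `u^s` is the Hardy–Littlewood–Sobolev integrand of `g = h^s`.
  set u : ℝ × ℝ → ℝ≥0∞ := fun p => h p.1 * h p.2 *
    ENNReal.ofReal (2 ^ (1 / r) * |p.1 - p.2| ^ (-(1 / r))) with hu
  set v : ℝ × ℝ → ℝ≥0∞ := fun p => ENNReal.ofReal |Real.sin (p.2 - p.1)| ^ (1 / r) *
    H (circlePoint p.1 + circlePoint p.2) with hv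
  have hum : Measurable u := by fun_prop
  have hvm : Measurable v := by fun_prop
  have hWuv : ∀ p ∈ orderedPairs a b, W p ≤ (u * v) p := by
    rintro ⟨x, y⟩ ⟨hx, hxy, hy⟩
    have := one_le_rpow_mul_sin_rpow (r := r) (by linarith) hxy
      (by simp only at hx hxy hy ⊢; linarith)
    calc W (x, y) = W (x, y) * 1 := (mul_one _).symm
      _ ≤ W (x, y) * _ := mul_le_mul_right this _
      _ = _ := by simp only [hW, hu, hv, Pi.mul_apply]; ring
  have hu_int : ∫⁻ p in orderedPairs a b, u p ^ s ≤
      c ^ s * (C₀ * (∫⁻ x, (g x : ℝ≥0∞) ^ (2 / (2 - lam))) ^ (2 - lam)) := by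
    calc ∫⁻ p in orderedPairs a b, u p ^ s
        ≤ ∫⁻ p in orderedPairs a b, c ^ s * (g p.1 * g p.2 *
            ENNReal.ofReal (|p.1 - p.2| ^ (-lam))) := by
          refine setLIntegral_mono' (measurableSet_orderedPairs a b) ?_
          rintro ⟨x, y⟩ ⟨hx, hxy, hy⟩
          simp only at hx hxy hy
          have hxy' : 0 < |x - y| := abs_pos.2 (by linarith)
          simp only [hu, hg]
          rw [Set.indicator_of_mem (by exact ⟨hx, hxy.trans hy⟩),
            Set.indicator_of_mem (by exact ⟨hx.trans hxy, hy⟩),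
            ENNReal.mul_rpow_of_nonneg _ _ hs0.le, ENNReal.mul_rpow_of_nonneg _ _ hs0.le,
            ENNReal.ofReal_mul (by positivity), ENNReal.mul_rpow_of_nonneg _ _ hs0.le,
            ENNReal.coe_rpow_of_nonneg _ hs0.le, ENNReal.coe_rpow_of_nonneg _ hs0.le,
            ENNReal.ofReal_rpow_of_pos (p := s) (Real.rpow_pos_of_pos hxy' _), ← Real.rpow_mul hxy'.le]
          have : -(1 / r) * s = -lam := by rw [hs, hlam]; field_simp
          rw [this]
          apply le_of_eq; ring
      _ ≤ ∫⁻ p : ℝ × ℝ, c ^ s * (g p.1 * g p.2 * ENNReal.ofReal (|p.1 - p.2| ^ (-lam))) :=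
          setLIntegral_le_lintegral _ _
      _ = c ^ s * ∫⁻ x, ∫⁻ y, g x * g y * ENNReal.ofReal (|x - y| ^ (-lam)) := by
          rw [lintegral_const_mul _ (by fun_prop), Measure.volume_eq_prod,
            lintegral_prod _ (by fun_prop)]
      _ ≤ _ := by gcongr; exact hC₀ g hgm
  have hv_int : ∫⁻ p in orderedPairs a b, v p ^ r ≤ ∫⁻ z, H z ^ r := by
    refine le_trans (le_of_eq (lintegral_congr fun p => ?_))
      (lintegral_circlePoint_add_le hab fun z => H z ^ r)
    simp only [hv]
    rw [ENNReal.mul_rpow_of_nonneg _ _ (by linarith), ← ENNReal.rpow_mul,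
      one_div_mul_cancel (by linarith), ENNReal.rpow_one]
  have hexp : (2 - lam) * (1 / s) = (2 * r - 3) / r := by rw [hs, hlam]; field_simp; ring
  rw [hprod]
  calc _ ≤ 2 * ∫⁻ p in orderedPairs a b, W p := by
        refine setLIntegral_prod_self_le_two_mul fun p => ?_
        simp only [hW, Prod.fst_swap, Prod.snd_swap]
        rw [mul_comm (h p.2 : ℝ≥0∞), add_comm (circlePoint p.2)]
    _ ≤ 2 * ∫⁻ p in orderedPairs a b, (u * v) p := by
        gcongr 1
        exact setLIntegral_mono' (measurableSet_orderedPairs a b) hWuv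
    _ ≤ 2 * ((∫⁻ p in orderedPairs a b, u p ^ s) ^ (1 / s) *
          (∫⁻ p in orderedPairs a b, v p ^ r) ^ (1 / r)) := by
        gcongr 1
        exact ENNReal.lintegral_mul_le_Lp_mul_Lq _ hconj hum.aemeasurable hvm.aemeasurable
    _ ≤ 2 * ((c ^ s * (C₀ * (∫⁻ x, (g x : ℝ≥0∞) ^ (2 / (2 - lam))) ^ (2 - lam))) ^ (1 / s) *
          (∫⁻ z, H z ^ r) ^ (1 / r)) := by gcongr
    _ = _ := by
        rw [hgint, ENNReal.mul_rpow_of_nonneg _ _ (by positivity),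
          ENNReal.mul_rpow_of_nonneg _ _ (by positivity), ← ENNReal.rpow_mul, ← ENNReal.rpow_mul,
          mul_one_div_cancel hs0.ne', ENNReal.rpow_one, hexp]
        ring

end BilinearArc

/-! ### Maximal functions over finitely many dilations. -/

section FiniteMaximal

/-- The maximal function over a finite set of dilations. -/
noncomputable def finiteMaximal (μ : Measure Plane) (T : Finset ℝ) (g : Plane → ℝ≥0∞)
    (x : Plane) : ℝ≥0∞ :=
  ⨆ t ∈ T, ∫⁻ y, g (x - t • y) ∂μ

variable {μ : Measure Plane}

theorem lintegral_le_finiteMaximal {T : Finset ℝ} {t : ℝ} (ht : t ∈ T) (g : Plane → ℝ≥0∞)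
    (x : Plane) : ∫⁻ y, g (x - t • y) ∂μ ≤ finiteMaximal μ T g x :=
  le_iSup₂ (f := fun t (_ : t ∈ T) => ∫⁻ y, g (x - t • y) ∂μ) t ht

theorem lintegral_dilate {g : Plane → ℂ} (hg : Measurable g) (t : ℝ) (x : Plane) :
    ∫⁻ y, ‖g (x - y)‖ₑ ∂(dilate μ t) = ∫⁻ y, ‖g (x - t • y)‖ₑ ∂μ :=
  lintegral_map (f := fun y => ‖g (x - y)‖ₑ) (by fun_prop) (by fun_prop)

theorem finiteMaximal_le_maximalFunction {T : Finset ℝ} (hT : ∀ t ∈ T, 0 < t) {g : Plane → ℂ}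
    (hg : Measurable g) (x : Plane) :
    finiteMaximal μ T (fun z => ‖g z‖ₑ) x ≤ maximalFunction μ g x := by
  refine iSup₂_le fun t ht => ?_
  rw [← lintegral_dilate hg]
  exact le_iSup₂ (f := fun (t : ℝ) (_ : 0 < t) => ∫⁻ y, ‖g (x - y)‖ₑ ∂(dilate μ t)) t (hT t ht)

theorem finiteMaximal_le_of_le {T : Finset ℝ} {g : Plane → ℝ≥0∞} {B : ℝ≥0∞} (hB : ∀ z, g z ≤ B)
    (x : Plane) : finiteMaximal μ T g x ≤ B * μ Set.univ :=
  iSup₂_le fun t _ => (lintegral_mono fun y => hB _).trans (by rw [lintegral_const])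

theorem measurable_finiteMaximal [SFinite μ] (T : Finset ℝ) {g : Plane → ℝ≥0∞}
    (hg : Measurable g) : Measurable (finiteMaximal μ T g) :=
  Measurable.biSup _ T.countable_toSet fun t _ =>
    Measurable.lintegral_prod_right' (f := fun p : Plane × Plane => g (p.1 - t • p.2)) (by fun_prop)

theorem exists_lintegral_finiteMaximal_le [SFinite μ] {r : ℝ} (hr : 0 < r)
    (hμ : MaximalBoundedOn μ (ENNReal.ofReal r)) :
    ∃ C : ℝ≥0, ∀ T : Finset ℝ, (∀ t ∈ T, 0 < t) → ∀ g : Plane → ℝ≥0∞, Measurable g →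
      (∀ z, g z ≠ ∞) → ∫⁻ x, finiteMaximal μ T g x ^ r ≤ C * ∫⁻ x, g x ^ r := by
  obtain ⟨C, hC⟩ := hμ
  -- The added `1` keeps the constant nonzero, so the bound stays trivial when the right-hand
  -- integral is infinite, where the hypothesis on `μ` says nothing.
  refine ⟨C ^ r + 1, fun T hT g hg hfin => ?_⟩
  rcases eq_or_ne (∫⁻ x, g x ^ r) ∞ with htop | htop
  · rw [htop, ENNReal.mul_top]
    · exact le_top
    · simp
  set f : Plane → ℂ := fun x => ((g x).toReal : ℂ) with hf
  have hfm : Measurable f := by fun_prop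
  have hfg : ∀ x, ‖f x‖ₑ = g x := fun x => by
    rw [hf, ← ofReal_norm, Complex.norm_real, Real.norm_of_nonneg ENNReal.toReal_nonneg,
      ENNReal.ofReal_toReal (hfin x)]
  have hr0 : ENNReal.ofReal r ≠ 0 := by simpa using hr
  have hnorm : ∀ {ε : Type} [ENorm ε] [TopologicalSpace ε] (u : Plane → ε),
      eLpNorm u (ENNReal.ofReal r) volume = (∫⁻ x, ‖u x‖ₑ ^ r) ^ (1 / r) := fun u => by
    rw [eLpNorm_eq_lintegral_rpow_enorm_toReal hr0 ENNReal.ofReal_ne_top,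
      ENNReal.toReal_ofReal hr.le]
  have hfLp : MemLp f (ENNReal.ofReal r) volume := by
    refine ⟨hfm.aestronglyMeasurable, ?_⟩
    rw [hnorm]
    simp_rw [hfg]
    exact ENNReal.rpow_lt_top_of_nonneg (by positivity) htop
  have h := hC f hfLp
  rw [hnorm, hnorm] at h
  simp_rw [hfg, enorm_eq_self] at h
  have h' := ENNReal.rpow_le_rpow h hr.le
  rw [ENNReal.mul_rpow_of_nonneg _ _ hr.le, ← ENNReal.rpow_mul, ← ENNReal.rpow_mul,
    one_div_mul_cancel hr.ne', ENNReal.rpow_one, ENNReal.rpow_one,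
    ← ENNReal.coe_rpow_of_nonneg _ hr.le] at h'
  calc ∫⁻ x, finiteMaximal μ T g x ^ r ≤ ∫⁻ x, maximalFunction μ f x ^ r := by
        refine lintegral_mono fun x => ENNReal.rpow_le_rpow ?_ hr.le
        have := finiteMaximal_le_maximalFunction (μ := μ) hT hfm x
        simp_rw [hfg] at this
        exact this
    _ ≤ _ := h'
    _ ≤ _ := by gcongr; exact le_self_add

/-- The iterate arises because squaring `G` produces two averages in `μ`. The bound `B` serves only
to keep the inner maximal function finite, so that the single estimate can be applied again. -/
theorem exists_lintegral_finiteMaximal_finiteMaximal_le [IsFiniteMeasure μ] {r : ℝ} (hr : 0 < r)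
    (hμ : MaximalBoundedOn μ (ENNReal.ofReal r)) :
    ∃ C : ℝ≥0, ∀ T : Finset ℝ, (∀ t ∈ T, 0 < t) → ∀ g : Plane → ℝ≥0∞, Measurable g →
      ∀ B : ℝ≥0∞, B ≠ ∞ → (∀ z, g z ≤ B) →
        ∫⁻ x, finiteMaximal μ T (finiteMaximal μ T g) x ^ r ≤ C * ∫⁻ x, g x ^ r := by
  obtain ⟨C, hC⟩ := exists_lintegral_finiteMaximal_le hr hμ
  refine ⟨C * C, fun T hT g hg B hB hgB => ?_⟩
  have h1 := hC T hT g hg fun z => ((hgB z).trans_lt hB.lt_top).ne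
  have h2 := hC T hT _ (measurable_finiteMaximal T hg) fun z =>
    ((finiteMaximal_le_of_le hgB z).trans_lt (ENNReal.mul_lt_top hB.lt_top (measure_lt_top μ _))).ne
  calc _ ≤ _ := h2
    _ ≤ C * (C * ∫⁻ x, g x ^ r) := by gcongr
    _ = _ := by push_cast; ring

/-- The supremum defining a finite maximal function is attained along a measurable selection. -/
theorem exists_measurable_selection {X : Type*} [MeasurableSpace X] {A : ℝ → X → ℝ≥0∞}
    (hA : Measurable (Function.uncurry A)) (T : Finset ℝ) (hT : T.Nonempty) :
    ∃ τ : X → ℝ, Measurable τ ∧ (∀ x, τ x ∈ T) ∧ ∀ x, ⨆ t ∈ T, A t x = A (τ x) x := by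
  induction hT using Finset.Nonempty.cons_induction with
  | singleton t => exact ⟨fun _ => t, measurable_const, by simp, by simp⟩
  | cons t T ht hT ih =>
    obtain ⟨τ, hτ, hmem, hsup⟩ := ih
    have hm1 : Measurable fun x => A (τ x) x := hA.comp (hτ.prodMk measurable_id)
    have hm2 : Measurable fun x => A t x := hA.comp (measurable_const.prodMk measurable_id)
    classical
    refine ⟨fun x => if A (τ x) x < A t x then t else τ x,
      Measurable.ite (measurableSet_lt hm1 hm2) measurable_const hτ, fun x => ?_, fun x => ?_⟩
    · dsimp only
      split_ifs <;> simp [hmem x]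
    · rw [Finset.cons_eq_insert, Finset.iSup_insert, hsup x]
      dsimp only
      split_ifs with h
      · exact sup_eq_left.2 h.le
      · exact sup_eq_right.2 (not_lt.1 h)

end FiniteMaximal

/-! ### The adjoint operator and its square. -/

section Extension

/-- The adjoint of `f ↦ c · (𝓕 f ∘ ψ)`: the Fourier transform of the image under `ψ` of the
complex measure `c ν`. -/
noncomputable def extensionOperator {Z : Type*} [MeasurableSpace Z] (ν : Measure Z) (c : Z → ℂ)
    (ψ : Z → Plane) (x : Plane) : ℂ :=
  ∫ z, c z * Complex.exp (↑(-2 * Real.pi * inner ℝ x (ψ z)) * Complex.I) ∂ν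

theorem norm_extensionOperator_le {Z : Type*} [MeasurableSpace Z] (ν : Measure Z) (c : Z → ℂ)
    (ψ : Z → Plane) (x : Plane) :
    ‖extensionOperator ν c ψ x‖ ≤ ∫ z, ‖c z‖ ∂ν :=
  (norm_integral_le_integral_norm _).trans
    (le_of_eq (by simp only [norm_mul, Complex.norm_exp_ofReal_mul_I, mul_one]))

section

variable {Z : Type*} [MeasurableSpace Z] {ν : Measure Z} [SFinite ν] {c : Z → ℂ} {ψ : Z → Plane}

theorem integral_mul_extensionOperator (hc : Integrable c ν) (hψ : Measurable ψ) {F : Plane → ℂ}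
    (hF : Integrable F) :
    ∫ x, F x * extensionOperator ν c ψ x = ∫ z, c z * 𝓕 F (ψ z) ∂ν := by
  have hint : Integrable (Function.uncurry fun (x : Plane) (z : Z) =>
      F x * (c z * Complex.exp (↑(-2 * Real.pi * inner ℝ x (ψ z)) * Complex.I))) (volume.prod ν) := by
    have h1 : Integrable (fun p : Plane × Z => F p.1 * c p.2) (volume.prod ν) := hF.mul_prod hc
    have h2 : Measurable fun p : Plane × Z =>
        Complex.exp (↑(-2 * Real.pi * inner ℝ p.1 (ψ p.2)) * Complex.I) := by
      fun_prop
    refine (h1.mul_bdd (c := 1) h2.aestronglyMeasurable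
      (Filter.Eventually.of_forall fun p => (Complex.norm_exp_ofReal_mul_I _).le)).congr
      (Filter.Eventually.of_forall fun p => ?_)
    simp only [Function.uncurry]; ring
  simp only [extensionOperator, ← integral_const_mul]
  rw [integral_integral_swap hint]
  refine integral_congr_ae (Filter.Eventually.of_forall fun z => ?_)
  simp only [Real.fourier_eq', ← integral_const_mul]
  refine integral_congr_ae (Filter.Eventually.of_forall fun x => ?_)
  simp only [smul_eq_mul]
  ring

/-- The square of a Fourier transform is the transform of a self-convolution, so it is an extension
operator again, now over sums of two points. -/
theorem extensionOperator_sq (x : Plane) :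
    extensionOperator ν c ψ x ^ 2 =
      extensionOperator (ν.prod ν) (fun p => c p.1 * c p.2) (fun p => ψ p.1 + ψ p.2) x := by
  simp only [extensionOperator]
  rw [sq, ← integral_prod_mul]
  refine integral_congr_ae (Filter.Eventually.of_forall fun p => ?_)
  simp only [inner_add_right, mul_add, Complex.ofReal_add, add_mul, Complex.exp_add]
  ring

theorem enorm_integral_mul_extensionOperator_sq_le (hc : Integrable c ν) (hψ : Measurable ψ)
    {F : Plane → ℂ} (hF : Integrable F) :
    ‖∫ x, F x * extensionOperator ν c ψ x ^ 2‖ₑ ≤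
      ∫⁻ z, ∫⁻ w, ‖c z‖ₑ * ‖c w‖ₑ * ‖𝓕 F (ψ z + ψ w)‖ₑ ∂ν ∂ν := by
  simp only [extensionOperator_sq]
  rw [integral_mul_extensionOperator (hc.mul_prod hc) (by fun_prop) hF]
  refine (enorm_integral_le_lintegral_enorm _).trans (le_of_eq ?_)
  have hFm := (continuous_fourier_of_integrable hF).measurable
  rw [lintegral_prod]
  · simp only [enorm_mul]
  · refine ((hc.mul_prod hc).1.mul ?_).enorm
    exact (hFm.comp (by fun_prop : Measurable fun p : Z × Z => ψ p.1 + ψ p.2)).aestronglyMeasurable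

theorem stronglyMeasurable_extensionOperator (hc : Measurable c) (hψ : Measurable ψ) :
    StronglyMeasurable (extensionOperator ν c ψ) := by
  have : StronglyMeasurable fun p : Plane × Z =>
      c p.2 * Complex.exp (↑(-2 * Real.pi * inner ℝ p.1 (ψ p.2)) * Complex.I) :=
    (by fun_prop : Measurable _).stronglyMeasurable
  exact this.integral_prod_right'

end

variable {μ : Measure Plane} [IsFiniteMeasure μ]

/-- The point `γ(θ) - τ(θ) y` at which the linearized maximal operator evaluates. -/
noncomputable def shiftedPoint (τ : ℝ → ℝ) (z : ℝ × Plane) : Plane :=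
  circlePoint z.1 - τ z.1 • z.2

@[fun_prop]
theorem measurable_shiftedPoint {τ : ℝ → ℝ} (hτ : Measurable τ) : Measurable (shiftedPoint τ) := by
  unfold shiftedPoint
  fun_prop

/-- A quadruple integral along shifted points is controlled by the iterated maximal function. -/
theorem lintegral_shiftedPoint_le {ρ : Measure ℝ} [SFinite ρ] {τ : ℝ → ℝ} (hτ : Measurable τ)
    {T : Finset ℝ} (hT : ∀ θ, τ θ ∈ T) {h : ℝ → ℝ≥0} (hh : Measurable h) {c : ℝ × Plane → ℂ}
    (hch : ∀ z, ‖c z‖ₑ ≤ h z.1) {g : Plane → ℝ≥0∞} (hg : Measurable g) :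
    ∫⁻ z, ∫⁻ w, ‖c z‖ₑ * ‖c w‖ₑ * g (shiftedPoint τ z + shiftedPoint τ w)
        ∂(ρ.prod μ) ∂(ρ.prod μ) ≤
      ∫⁻ x, ∫⁻ y, h x * h y *
        finiteMaximal μ T (finiteMaximal μ T g) (circlePoint x + circlePoint y) ∂ρ ∂ρ := by
  have hM := measurable_finiteMaximal (μ := μ) T hg
  have hMM := measurable_finiteMaximal (μ := μ) T hM
  -- One average at a time: with `y` fixed, the dilation `τ y` is a fixed element of `T`, so the
  -- average in the second copy of `μ` is at most a maximal function. The first copy is treated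
  -- likewise after Tonelli moves it innermost.
  have hin : ∀ u : Plane, ∫⁻ w, h w.1 * g (u + shiftedPoint τ w) ∂(ρ.prod μ) ≤
      ∫⁻ y, h y * finiteMaximal μ T g (u + circlePoint y) ∂ρ := by
    intro u
    rw [lintegral_prod _ (by fun_prop)]
    refine lintegral_mono fun y => ?_
    dsimp only
    rw [lintegral_const_mul' _ _ ENNReal.coe_ne_top]
    refine mul_le_mul_right (le_trans (le_of_eq (lintegral_congr fun v => ?_))
      (lintegral_le_finiteMaximal (hT y) g (u + circlePoint y))) _
    rw [shiftedPoint, add_sub_assoc]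
  calc _ ≤ ∫⁻ z, ∫⁻ w, h z.1 * (h w.1 * g (shiftedPoint τ z + shiftedPoint τ w))
        ∂(ρ.prod μ) ∂(ρ.prod μ) := by
        refine lintegral_mono fun z => lintegral_mono fun w => ?_
        dsimp only
        rw [mul_assoc]
        gcongr
        · exact hch z
        · exact hch w
    _ ≤ ∫⁻ z, h z.1 * ∫⁻ y, h y * finiteMaximal μ T g (shiftedPoint τ z + circlePoint y) ∂ρ
          ∂(ρ.prod μ) := by
        refine lintegral_mono fun z => ?_
        dsimp only
        rw [lintegral_const_mul' _ _ ENNReal.coe_ne_top]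
        gcongr
        exact hin _
    _ = ∫⁻ x, h x * ∫⁻ v, ∫⁻ y, h y *
          finiteMaximal μ T g (shiftedPoint τ (x, v) + circlePoint y) ∂ρ ∂μ ∂ρ := by
        have hm : Measurable fun z : ℝ × Plane => ∫⁻ y, h y *
            finiteMaximal μ T g (shiftedPoint τ z + circlePoint y) ∂ρ :=
          Measurable.lintegral_prod_right' (f := fun p : (ℝ × Plane) × ℝ => (h p.2 : ℝ≥0∞) *
            finiteMaximal μ T g (shiftedPoint τ p.1 + circlePoint p.2)) (by fun_prop)
        rw [lintegral_prod _ (by fun_prop)]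
        refine lintegral_congr fun x => ?_
        dsimp only
        rw [lintegral_const_mul' _ _ ENNReal.coe_ne_top]
    _ = ∫⁻ x, h x * ∫⁻ y, h y * ∫⁻ v,
          finiteMaximal μ T g (shiftedPoint τ (x, v) + circlePoint y) ∂μ ∂ρ ∂ρ := by
        refine lintegral_congr fun x => ?_
        rw [lintegral_lintegral_swap (by fun_prop)]
        congr 1
        refine lintegral_congr fun y => ?_
        rw [lintegral_const_mul' _ _ ENNReal.coe_ne_top]
    _ ≤ ∫⁻ x, h x * ∫⁻ y, h y *
          finiteMaximal μ T (finiteMaximal μ T g) (circlePoint x + circlePoint y) ∂ρ ∂ρ := by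
        gcongr with x y
        refine le_trans (le_of_eq (lintegral_congr fun v => ?_))
          (lintegral_le_finiteMaximal (hT x) _ (circlePoint x + circlePoint y))
        rw [shiftedPoint, add_sub_right_comm]
    _ = _ := by
        refine lintegral_congr fun x => ?_
        rw [← lintegral_const_mul' _ _ ENNReal.coe_ne_top]
        simp only [mul_assoc]

/-- The bilinear form of the extension estimate, tested against a function in `L¹ ∩ L²`. -/
theorem exists_enorm_integral_mul_extensionOperator_sq_le {r : ℝ} (hr : 2 < r)
    (hμ : MaximalBoundedOn μ (ENNReal.ofReal r)) :
    ∃ C : ℝ≥0, ∀ a b : ℝ, b - a ≤ 1 → ∀ T : Finset ℝ, (∀ t ∈ T, 0 < t) →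
      ∀ τ : ℝ → ℝ, Measurable τ → (∀ θ, τ θ ∈ T) → ∀ h : ℝ → ℝ≥0, Measurable h →
      ∀ c : ℝ × Plane → ℂ, Integrable c ((volume.restrict (Set.Ioo a b)).prod μ) →
      (∀ z, ‖c z‖ₑ ≤ h z.1) → ∀ F : Plane → ℂ, Integrable F → MemLp F 2 →
      ‖∫ x, F x * extensionOperator ((volume.restrict (Set.Ioo a b)).prod μ) c
          (shiftedPoint τ) x ^ 2‖ₑ ≤
        C * (∫⁻ x in Set.Ioo a b, (h x : ℝ≥0∞) ^ (2 * r / (2 * r - 3))) ^ ((2 * r - 3) / r) *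
          (∫⁻ x, ‖F x‖ₑ ^ (r / (r - 1))) ^ ((r - 1) / r) := by
  obtain ⟨C₁, hC₁⟩ := lintegral_arc_mul_mul_le hr
  obtain ⟨C₂, hC₂⟩ := exists_lintegral_finiteMaximal_finiteMaximal_le (by linarith) hμ
  have hr1 : 0 < r - 1 := by linarith
  have hr0 : 0 < r := by linarith
  obtain ⟨C₃, hC₃⟩ := lintegral_enorm_fourier_rpow_le (E := Plane) (s := r / (r - 1)) (r := r)
    (by rw [lt_div_iff₀ hr1]; linarith) (by rw [div_lt_iff₀ hr1]; linarith) (by field_simp; ring)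
  refine ⟨C₁ * (C₂ * C₃) ^ (1 / r), fun a b hab T hT τ hτ hτT h hh c hc hch F hF hF2 => ?_⟩
  have hg : Measurable fun z => ‖𝓕 F z‖ₑ := (continuous_fourier_of_integrable hF).measurable.enorm
  have hB := hC₂ T hT _ hg (∫⁻ x, ‖F x‖ₑ) hF.2.ne (enorm_fourier_le F)
  calc _ ≤ _ := enorm_integral_mul_extensionOperator_sq_le hc (measurable_shiftedPoint hτ) hF
    _ ≤ _ := lintegral_shiftedPoint_le hτ hτT hh hch hg
    _ ≤ _ := hC₁ a b hab h hh _ (measurable_finiteMaximal T (measurable_finiteMaximal T hg))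
    _ ≤ C₁ * (∫⁻ x in Set.Ioo a b, (h x : ℝ≥0∞) ^ (2 * r / (2 * r - 3))) ^ ((2 * r - 3) / r) *
          (C₂ * (C₃ * (∫⁻ x, ‖F x‖ₑ ^ (r / (r - 1))) ^ (r - 1))) ^ (1 / r) := by
        gcongr
        exact hB.trans (by gcongr; exact hC₃ F hF hF2)
    _ = _ := by
        rw [← mul_assoc (C₂ : ℝ≥0∞), ENNReal.mul_rpow_of_nonneg _ _ (by positivity),
          ← ENNReal.rpow_mul, ENNReal.coe_mul, ENNReal.coe_rpow_of_nonneg _ (by positivity),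
          ENNReal.coe_mul, mul_one_div]
        ring

end Extension

/-! ### Duality for the linearized maximal operator. -/

section LinearizedEstimate

/-- Divides out a power of `X` in the duality arguments; this needs `X` finite, which is why a
priori bounds are secured before each use. -/
theorem le_rpow_of_le_mul_rpow {X A : ℝ≥0∞} {θ : ℝ} (h0 : 0 < θ) (h1 : θ < 1) (hX : X ≠ ∞)
    (h : X ≤ A * X ^ (1 - θ)) : X ≤ A ^ (1 / θ) := by
  rcases eq_or_ne X 0 with hX0 | hX0
  · simp [hX0]
  have e : X = X ^ θ * X ^ (1 - θ) := by
    rw [← ENNReal.rpow_add _ _ hX0 hX]; simp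
  have hne : X ^ (1 - θ) ≠ 0 := by
    simp [ENNReal.rpow_eq_zero_iff, hX0, hX]
  have hnt : X ^ (1 - θ) ≠ ∞ := ENNReal.rpow_ne_top_of_nonneg (by linarith) hX
  have h2 : X ^ θ ≤ A := (ENNReal.mul_le_mul_iff_left hne hnt).1 (e.symm.le.trans h)
  calc X = (X ^ θ) ^ (1 / θ) := by rw [← ENNReal.rpow_mul, mul_one_div_cancel h0.ne', ENNReal.rpow_one]
    _ ≤ _ := ENNReal.rpow_le_rpow h2 (by positivity)

theorem memLp_indicator_ball_of_bound {F : Plane → ℂ} (hF : StronglyMeasurable F) {M : ℝ}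
    (hM : ∀ x, ‖F x‖ ≤ M) (R : ℝ) (p : ℝ≥0∞) :
    MemLp ((Metric.ball (0 : Plane) R).indicator F) p := by
  rw [memLp_indicator_iff_restrict measurableSet_ball]
  have : IsFiniteMeasure (volume.restrict (Metric.ball (0 : Plane) R)) :=
    ⟨by rw [Measure.restrict_apply_univ]; exact measure_ball_lt_top⟩
  exact MemLp.of_bound hF.aestronglyMeasurable M (Filter.Eventually.of_forall hM)

variable {μ : Measure Plane} [IsFiniteMeasure μ]

theorem integrable_of_enorm_le {a b : ℝ} {c : ℝ × Plane → ℂ} (hc : Measurable c) {h : ℝ → ℝ≥0}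
    {B : ℝ≥0} (hB : ∀ θ, h θ ≤ B) (hch : ∀ z, ‖c z‖ₑ ≤ h z.1) :
    Integrable c ((volume.restrict (Set.Ioo a b)).prod μ) := by
  have : IsFiniteMeasure (volume.restrict (Set.Ioo a b)) := ⟨by simp⟩
  refine Integrable.of_bound hc.aestronglyMeasurable (B : ℝ)
    (Filter.Eventually.of_forall fun z => ?_)
  have := (hch z).trans (ENNReal.coe_le_coe.2 (hB z.1))
  rw [enorm_eq_nnnorm, ENNReal.coe_le_coe] at this
  exact_mod_cast this

/-- The dual form of the maximal restriction estimate on a short arc. -/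
theorem exists_lintegral_extensionOperator_le {r : ℝ} (hr : 2 < r)
    (hμ : MaximalBoundedOn μ (ENNReal.ofReal r)) :
    ∃ C : ℝ≥0, ∀ a b : ℝ, b - a ≤ 1 → ∀ T : Finset ℝ, (∀ t ∈ T, 0 < t) →
      ∀ τ : ℝ → ℝ, Measurable τ → (∀ θ, τ θ ∈ T) → ∀ h : ℝ → ℝ≥0, Measurable h →
      ∀ B : ℝ≥0, (∀ θ, h θ ≤ B) → ∀ c : ℝ × Plane → ℂ, Measurable c →
      (∀ z, ‖c z‖ₑ ≤ h z.1) →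
      ∫⁻ x, ‖extensionOperator ((volume.restrict (Set.Ioo a b)).prod μ) c
          (shiftedPoint τ) x‖ₑ ^ (2 * r) ≤
        C * (∫⁻ x in Set.Ioo a b, (h x : ℝ≥0∞) ^ (2 * r / (2 * r - 3))) ^ (2 * r - 3) := by
  obtain ⟨C, hC⟩ := exists_enorm_integral_mul_extensionOperator_sq_le hr hμ
  have hr0 : 0 < r := by linarith
  have hr1 : 0 < r - 1 := by linarith
  refine ⟨C ^ r, fun a b hab T hT τ hτ hτT h hh B hB c hc hch => ?_⟩
  have hci := integrable_of_enorm_le (μ := μ) (a := a) (b := b) hc hB hch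
  set ν := (volume.restrict (Set.Ioo a b)).prod μ with hν
  set G := extensionOperator ν c (shiftedPoint τ) with hG
  have hGm : StronglyMeasurable G :=
    stronglyMeasurable_extensionOperator hc (measurable_shiftedPoint hτ)
  set M := ∫ z, ‖c z‖ ∂ν with hM
  have hGM : ∀ x, ‖G x‖ ≤ M := norm_extensionOperator_le ν c _
  set K := ∫⁻ x in Set.Ioo a b, (h x : ℝ≥0∞) ^ (2 * r / (2 * r - 3)) with hK
  -- The extremal function for the pairing with `G²`: both `F₀ * G²` and `‖F₀‖^(r/(r-1))` equal
  -- `‖G‖^(2r)`. The exponent `2r - 4` is positive because `r > 2`.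
  set F₀ : Plane → ℂ := fun x => (starRingEnd ℂ (G x)) ^ 2 * ((‖G x‖ ^ (2 * r - 4) : ℝ) : ℂ) with hF₀
  have hF₀n : ∀ x, ‖F₀ x‖ = ‖G x‖ ^ (2 * r - 2) := fun x => by
    rw [hF₀, norm_mul, norm_pow, RCLike.norm_conj, Complex.norm_real,
      Real.norm_of_nonneg (by positivity), ← Real.rpow_two,
      ← Real.rpow_add_of_nonneg (norm_nonneg _) (by norm_num) (by linarith)]
    ring_nf
  have hF₀G : ∀ x, F₀ x * G x ^ 2 = ((‖G x‖ ^ (2 * r) : ℝ) : ℂ) := fun x => by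
    have e1 : (starRingEnd ℂ (G x)) ^ 2 * G x ^ 2 = ((‖G x‖ ^ (4 : ℝ) : ℝ) : ℂ) := by
      rw [← mul_pow, mul_comm, Complex.mul_conj, Complex.normSq_eq_norm_sq]
      norm_cast
      rw [← pow_mul]
    calc F₀ x * G x ^ 2 = ((starRingEnd ℂ (G x)) ^ 2 * G x ^ 2) * ((‖G x‖ ^ (2 * r - 4) : ℝ) : ℂ) := by
          simp only [hF₀]; ring
      _ = _ := by
        rw [e1, ← Complex.ofReal_mul,
          ← Real.rpow_add_of_nonneg (norm_nonneg _) (by norm_num) (by linarith)]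
        ring_nf
  have hF₀m : StronglyMeasurable F₀ := by
    have := hGm.measurable
    exact Measurable.stronglyMeasurable (by fun_prop)
  have hF₀b : ∀ x, ‖F₀ x‖ ≤ M ^ (2 * r - 2) := fun x => by
    rw [hF₀n]
    exact Real.rpow_le_rpow (norm_nonneg _) (hGM x) (by linarith)
  -- `G` is bounded but not known to decay. Cutting off to a ball puts `F₀` in `L¹ ∩ L²` and makes
  -- `X` finite; the bound does not depend on `R`.
  have hball : ∀ R : ℝ, ∫⁻ x in Metric.ball (0 : Plane) R, ‖G x‖ₑ ^ (2 * r) ≤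
      (C * K ^ ((2 * r - 3) / r)) ^ r := by
    intro R
    set S := Metric.ball (0 : Plane) R with hS
    set X := ∫⁻ x in S, ‖G x‖ₑ ^ (2 * r) with hX
    have hXr : X = ∫⁻ x in S, ENNReal.ofReal (‖G x‖ ^ (2 * r)) := by
      refine lintegral_congr fun x => ?_
      rw [← ofReal_norm, ENNReal.ofReal_rpow_of_nonneg (norm_nonneg _) (by positivity)]
    have hint : Integrable (fun x => ‖G x‖ ^ (2 * r)) (volume.restrict S) := by
      have : IsFiniteMeasure (volume.restrict S) := ⟨by rw [Measure.restrict_apply_univ]; exact measure_ball_lt_top⟩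
      refine Integrable.of_bound (hGm.norm.measurable.pow_const _).aestronglyMeasurable (M ^ (2 * r))
        (Filter.Eventually.of_forall fun x => ?_)
      rw [Real.norm_of_nonneg (by positivity)]
      exact Real.rpow_le_rpow (norm_nonneg _) (hGM x) (by positivity)
    have hXtop : X ≠ ∞ := by
      rw [hXr, ← ofReal_integral_eq_lintegral_ofReal hint
        (Filter.Eventually.of_forall fun x => by positivity)]
      exact ENNReal.ofReal_ne_top
    have hmem := memLp_indicator_ball_of_bound hF₀m hF₀b R
    have hmain := hC a b hab T hT τ hτ hτT h hh c hci hch (S.indicator F₀)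
      (memLp_one_iff_integrable.1 (hmem 1)) (hmem 2)
    have hl : ‖∫ x, S.indicator F₀ x * G x ^ 2‖ₑ = X := by
      have e : ∀ x, S.indicator F₀ x * G x ^ 2 =
          S.indicator (fun x => ((‖G x‖ ^ (2 * r) : ℝ) : ℂ)) x := fun x => by
        by_cases hx : x ∈ S
        · simp only [Set.indicator_of_mem hx, hF₀G]
        · simp only [Set.indicator_of_notMem hx, zero_mul]
      simp_rw [e]
      rw [integral_indicator measurableSet_ball, integral_complex_ofReal, ← ofReal_norm,
        Complex.norm_real, Real.norm_of_nonneg (integral_nonneg fun x => by positivity),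
        ofReal_integral_eq_lintegral_ofReal hint
        (Filter.Eventually.of_forall fun x => by positivity), hXr]
    have hrr : ∫⁻ x, ‖S.indicator F₀ x‖ₑ ^ (r / (r - 1)) = X := by
      rw [hX, ← lintegral_indicator measurableSet_ball]
      refine lintegral_congr fun x => ?_
      by_cases hx : x ∈ S
      · rw [Set.indicator_of_mem hx, Set.indicator_of_mem hx, ← ofReal_norm, hF₀n,
          ← ENNReal.ofReal_rpow_of_nonneg (norm_nonneg _) (by linarith), ofReal_norm,
          ← ENNReal.rpow_mul]
        congr 1
        field_simp
      · rw [Set.indicator_of_notMem hx, Set.indicator_of_notMem hx, enorm_zero,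
          ENNReal.zero_rpow_of_pos (by positivity)]
    rw [hl, hrr] at hmain
    have hexp : (r - 1) / r = 1 - 1 / r := by field_simp
    rw [hexp] at hmain
    have := le_rpow_of_le_mul_rpow (by positivity) (by rw [div_lt_one hr0]; linarith) hXtop hmain
    rwa [one_div_one_div] at this
  have hmono : Monotone fun n : ℕ => Metric.ball (0 : Plane) n :=
    fun m n hmn => Metric.ball_subset_ball (by exact_mod_cast hmn)
  calc ∫⁻ x, ‖G x‖ₑ ^ (2 * r) = ∫⁻ x in ⋃ n : ℕ, Metric.ball (0 : Plane) n, ‖G x‖ₑ ^ (2 * r) := by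
        rw [Metric.iUnion_ball_nat, setLIntegral_univ]
    _ = ⨆ n : ℕ, ∫⁻ x in Metric.ball (0 : Plane) n, ‖G x‖ₑ ^ (2 * r) :=
        setLIntegral_iUnion_of_directed _ hmono.directed_le
    _ ≤ (C * K ^ ((2 * r - 3) / r)) ^ r := iSup_le fun n => hball n
    _ = _ := by
        rw [ENNReal.mul_rpow_of_nonneg _ _ hr0.le, ← ENNReal.rpow_mul,
          div_mul_cancel₀ _ hr0.ne', ENNReal.coe_rpow_of_nonneg _ hr0.le]

/-- The maximal restriction estimate on a short arc, over finitely many dilations. -/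
theorem exists_lintegral_arc_finiteMaximal_fourier_le {r : ℝ} (hr : 2 < r)
    (hμ : MaximalBoundedOn μ (ENNReal.ofReal r)) :
    ∃ C : ℝ≥0, ∀ a b : ℝ, b - a ≤ 1 → ∀ T : Finset ℝ, T.Nonempty → (∀ t ∈ T, 0 < t) →
      ∀ f : Plane → ℂ, Integrable f →
      ∫⁻ θ in Set.Ioo a b, finiteMaximal μ T (fun z => ‖𝓕 f z‖ₑ) (circlePoint θ) ^ (2 * r / 3) ≤
        C * ((∫⁻ x, ‖f x‖ₑ ^ (2 * r / (2 * r - 1))) ^ ((2 * r - 1) / (2 * r))) ^ (2 * r / 3) := by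
  obtain ⟨C, hC⟩ := exists_lintegral_extensionOperator_le hr hμ
  have hr0 : 0 < r := by linarith
  have hr3 : 0 < 2 * r - 3 := by linarith
  have hr1 : 0 < 2 * r - 1 := by linarith
  refine ⟨(C ^ (1 / (2 * r))) ^ (2 * r / 3), fun a b hab T hTne hT f hf => ?_⟩
  have hfc := continuous_fourier_of_integrable hf
  have hfm := hfc.measurable
  obtain ⟨τ, hτ, hτT, hsel⟩ := exists_measurable_selection
    (A := fun t θ => ∫⁻ y, ‖𝓕 f (circlePoint θ - t • y)‖ₑ ∂μ)
    (Measurable.lintegral_prod_right' (f := fun p : (ℝ × ℝ) × Plane =>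
      ‖𝓕 f (circlePoint p.1.2 - p.1.1 • p.2)‖ₑ) (by fun_prop)) T hTne
  set m : ℝ → ℝ≥0∞ := fun θ => finiteMaximal μ T (fun z => ‖𝓕 f z‖ₑ) (circlePoint θ) with hm
  have hmsel : ∀ θ, m θ = ∫⁻ y, ‖𝓕 f (shiftedPoint τ (θ, y))‖ₑ ∂μ := hsel
  have hmm : Measurable m := (measurable_finiteMaximal T hfm.enorm).comp measurable_circlePoint
  set B := (∫⁻ x, ‖f x‖ₑ) * μ Set.univ with hB
  have hBtop : B ≠ ∞ := ENNReal.mul_ne_top hf.2.ne (measure_ne_top _ _)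
  have hmB : ∀ θ, m θ ≤ B := fun θ => finiteMaximal_le_of_le (enorm_fourier_le f) _
  have hmtop : ∀ θ, m θ ≠ ∞ := fun θ => ((hmB θ).trans_lt hBtop.lt_top).ne
  set q : ℝ := 2 * r / 3 with hq
  have hq1 : 1 < q := by rw [hq, lt_div_iff₀ (by norm_num)]; linarith
  have hmq : ∀ θ, m θ ^ (q - 1) ≠ ∞ := fun θ =>
    ENNReal.rpow_ne_top_of_nonneg (by linarith) (hmtop θ)
  -- The function dual to `m` in `L^q`: `m * h = m^q` and `h^(q') = m^q`, with `q' = 2r/(2r-3)`.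
  set h : ℝ → ℝ≥0 := fun θ => (m θ ^ (q - 1)).toNNReal with hh
  have hhm : Measurable h := (hmm.pow_const _).ennreal_toNNReal
  have hhe : ∀ θ, (h θ : ℝ≥0∞) = m θ ^ (q - 1) := fun θ => ENNReal.coe_toNNReal (hmq θ)
  have hhB : ∀ θ, h θ ≤ (B ^ (q - 1)).toNNReal := fun θ =>
    ENNReal.toNNReal_mono (ENNReal.rpow_ne_top_of_nonneg (by linarith) hBtop)
      (ENNReal.rpow_le_rpow (hmB θ) (by linarith))
  set w : ℝ × Plane → ℂ := fun z => 𝓕 f (shiftedPoint τ z) with hw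
  have hwm : Measurable w := hfm.comp (measurable_shiftedPoint hτ)
  -- The unimodular factor removes the phase of `w`, so that `c * w = h * ‖w‖`. Where `w = 0` the
  -- quotient is `0` by convention and both sides vanish.
  set c : ℝ × Plane → ℂ := fun z => ((h z.1 : ℝ) : ℂ) * (starRingEnd ℂ (w z) / (‖w z‖ : ℂ)) with hc
  have hcm : Measurable c := by fun_prop
  have hch : ∀ z, ‖c z‖ₑ ≤ h z.1 := fun z => by
    rw [enorm_eq_nnnorm, ENNReal.coe_le_coe, ← NNReal.coe_le_coe, coe_nnnorm, hc, norm_mul,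
      norm_div, RCLike.norm_conj, Complex.norm_real, Complex.norm_real, norm_norm,
      Real.norm_of_nonneg (NNReal.coe_nonneg _)]
    exact mul_le_of_le_one_right (NNReal.coe_nonneg _) (div_self_le_one _)
  have hcw : ∀ z, c z * w z = ((h z.1 * ‖w z‖ : ℝ) : ℂ) := fun z => by
    rcases eq_or_ne (w z) 0 with h0 | h0
    · simp [h0]
    · have hn : (‖w z‖ : ℂ) ≠ 0 := by simpa using h0
      have e : starRingEnd ℂ (w z) * w z = (‖w z‖ : ℂ) * ‖w z‖ := by
        rw [mul_comm, Complex.mul_conj, Complex.normSq_eq_norm_sq]; push_cast; ring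
      simp only [hc]
      rw [mul_assoc, div_mul_eq_mul_div, e, mul_div_cancel_right₀ _ hn]
      push_cast
      ring
  set ν := (volume.restrict (Set.Ioo a b)).prod μ with hν
  have hci : Integrable c ν := integrable_of_enorm_le hcm hhB hch
  set G := extensionOperator ν c (shiftedPoint τ) with hG
  set Y := ∫⁻ θ in Set.Ioo a b, m θ ^ q with hY
  have hYtop : Y ≠ ∞ := by
    refine ne_top_of_le_ne_top ?_ (setLIntegral_mono' (g := fun _ => B ^ q) measurableSet_Ioo
      fun θ _ => ENNReal.rpow_le_rpow (hmB θ) (by linarith))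
    rw [setLIntegral_const]
    exact ENNReal.mul_ne_top (ENNReal.rpow_ne_top_of_nonneg (by linarith) hBtop) (by simp)
  have hYG : Y = ‖∫ x, f x * G x‖ₑ := by
    rw [integral_mul_extensionOperator hci (measurable_shiftedPoint hτ) hf]
    have hint : Integrable (fun z => (h z.1 * ‖w z‖ : ℝ)) ν := by
      have hb : Integrable (fun z => c z * w z) ν :=
        hci.mul_bdd (c := (∫⁻ x, ‖f x‖ₑ).toReal) hwm.aestronglyMeasurable
          (Filter.Eventually.of_forall fun z => by
            rw [← toReal_enorm]
            exact ENNReal.toReal_mono hf.2.ne (enorm_fourier_le f _))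
      simp_rw [hcw] at hb
      exact hb.norm.congr (Filter.Eventually.of_forall fun z => by
        simp only [Complex.norm_real]
        exact Real.norm_of_nonneg (by positivity))
    have e : ∫ z, c z * 𝓕 f (shiftedPoint τ z) ∂ν = ((∫ z, (h z.1 * ‖w z‖ : ℝ) ∂ν : ℝ) : ℂ) := by
      rw [← integral_complex_ofReal]
      exact integral_congr_ae (Filter.Eventually.of_forall hcw)
    rw [e, ← ofReal_norm, Complex.norm_real,
      Real.norm_of_nonneg (integral_nonneg fun z => by positivity),
      ofReal_integral_eq_lintegral_ofReal hint (Filter.Eventually.of_forall fun z => by positivity),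
      lintegral_prod _ (by fun_prop)]
    refine lintegral_congr fun θ => ?_
    have : ∀ y, ENNReal.ofReal (h θ * ‖w (θ, y)‖) = h θ * ‖w (θ, y)‖ₑ := fun y => by
      rw [ENNReal.ofReal_mul (NNReal.coe_nonneg _), ENNReal.ofReal_coe_nnreal, ofReal_norm]
    simp only [this]
    rw [lintegral_const_mul' _ _ ENNReal.coe_ne_top, hhe, hw, ← hmsel]
    nth_rewrite 3 [← ENNReal.rpow_one (m θ)]
    rw [← ENNReal.rpow_add_of_nonneg _ _ (by linarith) (by norm_num), sub_add_cancel]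
  have hYh : ∫⁻ θ in Set.Ioo a b, (h θ : ℝ≥0∞) ^ (2 * r / (2 * r - 3)) = Y := by
    refine lintegral_congr fun θ => ?_
    rw [hhe, ← ENNReal.rpow_mul]
    congr 1
    rw [hq]; field_simp
  have hGbd := hC a b hab T hT τ hτ hτT h hhm _ hhB c hcm hch
  rw [hYh] at hGbd
  have hconj : (2 * r / (2 * r - 1)).HolderConjugate (2 * r) := by
    rw [Real.holderConjugate_iff]
    refine ⟨by rw [lt_div_iff₀ hr1]; linarith, ?_⟩
    field_simp; ring
  have hGm : StronglyMeasurable G :=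
    stronglyMeasurable_extensionOperator hcm (measurable_shiftedPoint hτ)
  have hfin : Y ≤ (C : ℝ≥0∞) ^ (1 / (2 * r)) *
      (∫⁻ x, ‖f x‖ₑ ^ (2 * r / (2 * r - 1))) ^ ((2 * r - 1) / (2 * r)) * Y ^ (1 - 1 / q) := by
    calc Y ≤ ∫⁻ x, ‖f x‖ₑ * ‖G x‖ₑ := by
          rw [hYG]
          refine (enorm_integral_le_lintegral_enorm _).trans (le_of_eq ?_)
          simp only [enorm_mul]
      _ ≤ (∫⁻ x, ‖f x‖ₑ ^ (2 * r / (2 * r - 1))) ^ (1 / (2 * r / (2 * r - 1))) *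
          (∫⁻ x, ‖G x‖ₑ ^ (2 * r)) ^ (1 / (2 * r)) :=
          ENNReal.lintegral_mul_le_Lp_mul_Lq volume hconj hf.1.enorm hGm.measurable.enorm.aemeasurable
      _ ≤ (∫⁻ x, ‖f x‖ₑ ^ (2 * r / (2 * r - 1))) ^ (1 / (2 * r / (2 * r - 1))) *
          (C * Y ^ (2 * r - 3)) ^ (1 / (2 * r)) := by gcongr
      _ = _ := by
          rw [ENNReal.mul_rpow_of_nonneg _ _ (by positivity), ← ENNReal.rpow_mul, one_div_div]
          have : (2 * r - 3) * (1 / (2 * r)) = 1 - 1 / q := by rw [hq]; field_simp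
          rw [this]; ring
  have := le_rpow_of_le_mul_rpow (by positivity) (by rw [div_lt_one (by linarith)]; exact hq1)
    hYtop hfin
  rw [one_div_one_div, ENNReal.mul_rpow_of_nonneg _ _ (by linarith)] at this
  rwa [ENNReal.coe_rpow_of_nonneg _ (by linarith), ENNReal.coe_rpow_of_nonneg _ (by positivity)]

end LinearizedEstimate

/-! ### From finitely many dilations on arcs to the full supremum on the circle. -/

section MaximalRestriction

theorem maximalFunction_fourier_le (μ : Measure Plane) {f : Plane → ℂ} (hf : Integrable f) (x : Plane) :
    maximalFunction μ (𝓕 f) x ≤ (∫⁻ x, ‖f x‖ₑ) * μ Set.univ := by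
  refine iSup₂_le fun t _ => ?_
  rw [lintegral_dilate (continuous_fourier_of_integrable hf).measurable]
  exact (lintegral_mono fun y => enorm_fourier_le f _).trans (by rw [lintegral_const])

variable {μ : Measure Plane} [IsFiniteMeasure μ]

/-- Continuity in the dilation parameter lets rational dilations replace all positive ones. -/
theorem continuous_lintegral_shift {f : Plane → ℂ} (hf : Integrable f) (x : Plane) :
    Continuous fun t : ℝ => ∫⁻ y, ‖𝓕 f (x - t • y)‖ₑ ∂μ := by
  have hfc := continuous_fourier_of_integrable hf
  refine continuous_iff_continuousAt.2 fun t => ?_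
  refine tendsto_lintegral_filter_of_dominated_convergence (fun _ => ∫⁻ x, ‖f x‖ₑ)
    (Filter.Eventually.of_forall fun s => ?_)
    (Filter.Eventually.of_forall fun s => Filter.Eventually.of_forall fun y => enorm_fourier_le f _)
    ?_ (Filter.Eventually.of_forall fun y => ?_)
  · exact (hfc.comp (by fun_prop)).enorm.measurable
  · rw [lintegral_const]
    exact ENNReal.mul_ne_top hf.2.ne (measure_ne_top _ _)
  · exact ((hfc.comp (by fun_prop)).enorm.continuousAt (x := t))

/-- An increasing sequence of finite sets of dilations that exhausts the positive rationals. -/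
theorem exists_finite_dilations :
    ∃ T : ℕ → Finset ℝ, Monotone T ∧ (∀ n, (T n).Nonempty) ∧ (∀ n, ∀ t ∈ T n, 0 < t) ∧
      ∀ (μ : Measure Plane) [IsFiniteMeasure μ] (f : Plane → ℂ), Integrable f → ∀ x,
        maximalFunction μ (𝓕 f) x = ⨆ n, finiteMaximal μ (T n) (fun z => ‖𝓕 f z‖ₑ) x := by
  have hcount : (Set.Ioi (0 : ℝ) ∩ Set.range ((↑) : ℚ → ℝ)).Countable :=
    (Set.countable_range _).mono Set.inter_subset_right
  obtain ⟨u, hu⟩ := hcount.exists_eq_range ⟨1, by simp, 1, by simp⟩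
  have hupos : ∀ n, 0 < u n := fun n => (hu.symm ▸ Set.mem_range_self n :
    u n ∈ Set.Ioi (0 : ℝ) ∩ Set.range ((↑) : ℚ → ℝ)).1
  have hTpos : ∀ n, ∀ t ∈ (Finset.range (n + 1)).image u, 0 < t := fun n t ht => by
    obtain ⟨k, -, rfl⟩ := Finset.mem_image.1 ht
    exact hupos k
  -- `u` enumerates the positive rationals, and `n + 1` makes every set nonempty, as the measurable
  -- selection requires.
  refine ⟨fun n => (Finset.range (n + 1)).image u, fun m n hmn =>
    Finset.image_subset_image (Finset.range_mono (by omega)), fun n => by simp, hTpos,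
    fun μ _ f hf x => ?_⟩
  have hfm := (continuous_fourier_of_integrable hf).measurable
  refine le_antisymm (iSup₂_le fun t ht => ?_)
    (iSup_le fun n => finiteMaximal_le_maximalFunction (hTpos n) hfm x)
  rw [lintegral_dilate hfm]
  have hclosed : IsClosed {t : ℝ | ∫⁻ y, ‖𝓕 f (x - t • y)‖ₑ ∂μ ≤
      ⨆ n, finiteMaximal μ ((Finset.range (n + 1)).image u) (fun z => ‖𝓕 f z‖ₑ) x} :=
    isClosed_le (continuous_lintegral_shift hf x) continuous_const
  have hsub : Set.Ioi (0 : ℝ) ∩ Set.range ((↑) : ℚ → ℝ) ⊆ {t : ℝ | ∫⁻ y, ‖𝓕 f (x - t • y)‖ₑ ∂μ ≤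
      ⨆ n, finiteMaximal μ ((Finset.range (n + 1)).image u) (fun z => ‖𝓕 f z‖ₑ) x} := by
    intro s hs
    rw [hu] at hs
    obtain ⟨k, rfl⟩ := hs
    rw [Set.mem_ofPred_eq]
    exact le_iSup_of_le (f := fun n => finiteMaximal μ ((Finset.range (n + 1)).image u)
      (fun z => ‖𝓕 f z‖ₑ) x) k (lintegral_le_finiteMaximal
      (Finset.mem_image_of_mem u (Finset.self_mem_range_succ k)) (fun z => ‖𝓕 f z‖ₑ) x)
  exact (hclosed.closure_subset_iff.2 hsub)
    (Rat.denseRange_cast.open_subset_closure_inter isOpen_Ioi ht)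

theorem measurable_maximalFunction_fourier {f : Plane → ℂ} (hf : Integrable f) :
    Measurable (maximalFunction μ (𝓕 f)) := by
  obtain ⟨T, -, -, -, hT⟩ := exists_finite_dilations
  have : maximalFunction μ (𝓕 f) = fun x => ⨆ n, finiteMaximal μ (T n) (fun z => ‖𝓕 f z‖ₑ) x :=
    funext (hT μ f hf)
  rw [this]
  exact Measurable.iSup fun n =>
    measurable_finiteMaximal _ (continuous_fourier_of_integrable hf).measurable.enorm

theorem exists_lintegral_arc_maximalFunction_fourier_le {r : ℝ} (hr : 2 < r)
    (hμ : MaximalBoundedOn μ (ENNReal.ofReal r)) :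
    ∃ C : ℝ≥0, ∀ a b : ℝ, b - a ≤ 1 → ∀ f : Plane → ℂ, Integrable f →
      ∫⁻ θ in Set.Ioo a b, maximalFunction μ (𝓕 f) (circlePoint θ) ^ (2 * r / 3) ≤
        C * ((∫⁻ x, ‖f x‖ₑ ^ (2 * r / (2 * r - 1))) ^ ((2 * r - 1) / (2 * r))) ^ (2 * r / 3) := by
  obtain ⟨C, hC⟩ := exists_lintegral_arc_finiteMaximal_fourier_le hr hμ
  refine ⟨C, fun a b hab f hf => ?_⟩
  obtain ⟨T, hTmono, hTne, hTpos, hT⟩ := exists_finite_dilations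
  have hq : 0 < 2 * r / 3 := by positivity
  have hmeas : ∀ n, Measurable (finiteMaximal μ (T n) fun z => ‖𝓕 f z‖ₑ) := fun n =>
    measurable_finiteMaximal _ (continuous_fourier_of_integrable hf).measurable.enorm
  have hmono : ∀ x, Monotone fun n => finiteMaximal μ (T n) (fun z => ‖𝓕 f z‖ₑ) x :=
    fun x m n hmn => iSup₂_le fun t ht => lintegral_le_finiteMaximal (hTmono hmn ht) _ x
  have e : ∀ θ, maximalFunction μ (𝓕 f) (circlePoint θ) ^ (2 * r / 3) =
      ⨆ n, finiteMaximal μ (T n) (fun z => ‖𝓕 f z‖ₑ) (circlePoint θ) ^ (2 * r / 3) := fun θ => by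
    rw [hT μ f hf]
    exact (ENNReal.orderIsoRpow _ hq).map_iSup _
  simp_rw [e]
  have hrm : ∀ n, Measurable fun θ =>
      finiteMaximal μ (T n) (fun z => ‖𝓕 f z‖ₑ) (circlePoint θ) ^ (2 * r / 3) := fun n =>
    ((hmeas n).comp measurable_circlePoint).pow_const _
  rw [lintegral_iSup hrm fun m n hmn θ => ENNReal.rpow_le_rpow (hmono _ hmn) hq.le]
  exact iSup_le fun n => hC a b hab (T n) (hTne n) (hTpos n) f hf

theorem lintegral_circleMeasure {φ : Plane → ℝ≥0∞} (hφ : Measurable φ) :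
    ∫⁻ x, φ x ∂circleMeasure = ∫⁻ θ in Set.Ico 0 (2 * Real.pi), φ (circlePoint θ) :=
  lintegral_map hφ measurable_circlePoint

theorem circleMeasure_univ : circleMeasure Set.univ = ENNReal.ofReal (2 * Real.pi) := by
  have := lintegral_circleMeasure (φ := fun _ => 1) measurable_const
  simpa using this

theorem circleMeasure_univ_rpow_le {e : ℝ} (he : e ≤ 1) :
    circleMeasure Set.univ ^ e ≤ ENNReal.ofReal (2 * Real.pi) := by
  rw [circleMeasure_univ]
  conv_rhs => rw [← ENNReal.rpow_one (ENNReal.ofReal (2 * Real.pi))]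
  refine ENNReal.rpow_le_rpow_of_exponent_le ?_ he
  rw [ENNReal.one_le_ofReal]
  linarith [Real.pi_gt_three]

/-- The circle is covered by seven arcs of unit length. -/
theorem lintegral_circleMeasure_le {φ : Plane → ℝ≥0∞} (hφ : Measurable φ) {A : ℝ≥0∞}
    (hA : ∀ a b : ℝ, b - a ≤ 1 → ∫⁻ θ in Set.Ioo a b, φ (circlePoint θ) ≤ A) :
    ∫⁻ x, φ x ∂circleMeasure ≤ 7 * A := by
  rw [lintegral_circleMeasure hφ]
  have hsub : Set.Ico 0 (2 * Real.pi) ⊆ ⋃ k : Fin 7, Set.Ico (k : ℝ) (k + 1) := by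
    rintro θ ⟨h0, h1⟩
    have hlt : ⌊θ⌋₊ < 7 := by
      rw [Nat.floor_lt h0]
      push_cast
      linarith [Real.pi_lt_d2]
    exact Set.mem_iUnion.2 ⟨⟨⌊θ⌋₊, hlt⟩, Nat.floor_le h0, Nat.lt_floor_add_one θ⟩
  calc _ ≤ ∫⁻ θ in ⋃ k : Fin 7, Set.Ico (k : ℝ) (k + 1), φ (circlePoint θ) :=
        lintegral_mono_set hsub
    _ ≤ ∑' k : Fin 7, ∫⁻ θ in Set.Ico (k : ℝ) (k + 1), φ (circlePoint θ) :=
        lintegral_iUnion_le _ _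
    _ ≤ ∑' _ : Fin 7, A := by
        refine ENNReal.tsum_le_tsum fun k => ?_
        rw [setLIntegral_congr Ioo_ae_eq_Ico.symm]
        exact hA _ _ (by simp)
    _ = 7 * A := by simp

/-- The maximal restriction estimate at the endpoint `q = p' / 3`. -/
theorem exists_eLpNorm_maximalFunction_fourier_le {r : ℝ} (hr : 2 < r)
    (hμ : MaximalBoundedOn μ (ENNReal.ofReal r)) :
    ∃ C : ℝ≥0, ∀ f : Plane → ℂ, Integrable f →
      eLpNorm (maximalFunction μ (𝓕 f)) (ENNReal.ofReal (2 * r / 3)) circleMeasure ≤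
        C * eLpNorm f (ENNReal.ofReal (2 * r / (2 * r - 1))) volume := by
  obtain ⟨C, hC⟩ := exists_lintegral_arc_maximalFunction_fourier_le hr hμ
  have hq : 0 < 2 * r / 3 := by positivity
  have hp : 0 < 2 * r / (2 * r - 1) := div_pos (by linarith) (by linarith)
  refine ⟨(7 * C) ^ (1 / (2 * r / 3)), fun f hf => ?_⟩
  have h := lintegral_circleMeasure_le
    ((measurable_maximalFunction_fourier (μ := μ) hf).pow_const (2 * r / 3))
    fun a b hab => hC a b hab f hf
  rw [eLpNorm_eq_lintegral_rpow_enorm_toReal (by simpa using hq) ENNReal.ofReal_ne_top,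
    eLpNorm_eq_lintegral_rpow_enorm_toReal (by simpa using hp) ENNReal.ofReal_ne_top,
    ENNReal.toReal_ofReal hq.le, ENNReal.toReal_ofReal hp.le]
  simp only [enorm_eq_self]
  refine (ENNReal.rpow_le_rpow h (by positivity)).trans (le_of_eq ?_)
  rw [← mul_assoc, ENNReal.mul_rpow_of_nonneg _ _ (by positivity), ← ENNReal.rpow_mul,
    mul_one_div_cancel hq.ne', ENNReal.rpow_one, one_div_div (2 * r) (2 * r - 1),
    ENNReal.coe_rpow_of_nonneg _ (by positivity)]
  push_cast
  rfl

end MaximalRestriction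

/-- The case `p = 1`: the maximal function is at most `‖f‖₁ μ(ℝ²)` everywhere, and `(2π)^(1/q) ≤ 2π`
makes the constant uniform in `q`. -/
theorem eLpNorm_maximalFunction_fourier_le_one {μ : Measure Plane} {f : Plane → ℂ}
    (hf : Integrable f) {q : ℝ≥0∞}
    (hq : 1 ≤ q) :
    eLpNorm (maximalFunction μ (𝓕 f)) q circleMeasure ≤
      ENNReal.ofReal (2 * Real.pi) * μ Set.univ * eLpNorm f 1 volume := by
  have hle : q.toReal⁻¹ ≤ 1 := by
    rcases eq_or_ne q ∞ with rfl | hqt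
    · simp
    · exact inv_le_one_of_one_le₀ (by
        rw [← ENNReal.toReal_one]; exact ENNReal.toReal_mono hqt hq)
  rw [eLpNorm_one_eq_lintegral_enorm]
  refine (eLpNorm_le_of_ae_enorm_bound (C := (∫⁻ x, ‖f x‖ₑ) * μ Set.univ)
    (Filter.Eventually.of_forall fun x => ?_)).trans ?_
  · simpa using maximalFunction_fourier_le μ hf x
  · rw [smul_eq_mul]
    calc _ ≤ (∫⁻ x, ‖f x‖ₑ) * μ Set.univ * ENNReal.ofReal (2 * Real.pi) :=
          mul_le_mul_right (circleMeasure_univ_rpow_le hle) _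
      _ = _ := by ring

theorem theorem1 (μ : Measure Plane) [IsFiniteMeasure μ]
    (hμ : ∀ r : ℝ≥0∞, 2 < r → r < ∞ → MaximalBoundedOn μ r)
    (p p' : ℝ≥0∞) (hp : 1 ≤ p) (hp_lt : p < 4 / 3) (hpp' : ENNReal.HolderConjugate p p') :
    ∃ C : ℝ≥0, ∀ q : ℝ≥0∞, 1 ≤ q → 3 * q ≤ p' →
      ∀ f : Plane → ℂ, Integrable f volume → MemLp f p volume →
        eLpNorm (maximalFunction μ (𝓕 f)) q circleMeasure ≤ C * eLpNorm f p volume := by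
  rcases hp.eq_or_lt with rfl | hp1
  · refine ⟨(ENNReal.ofReal (2 * Real.pi) * μ Set.univ).toNNReal, fun q hq _ f hf _ => ?_⟩
    rw [ENNReal.coe_toNNReal (ENNReal.mul_ne_top ENNReal.ofReal_ne_top (measure_ne_top _ _))]
    exact eLpNorm_maximalFunction_fourier_le_one hf hq
  have hptop : p ≠ ∞ := hp_lt.ne_top
  set P := p.toReal with hP
  have hpP : p = ENNReal.ofReal P := (ENNReal.ofReal_toReal hptop).symm
  have hP1 : 1 < P := by
    rw [hP, ← ENNReal.toReal_one]
    exact (ENNReal.toReal_lt_toReal ENNReal.one_ne_top hptop).2 hp1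
  have hP43 : P < 4 / 3 := by
    have := (ENNReal.toReal_lt_toReal hptop (ENNReal.div_ne_top (by simp) (by simp))).2 hp_lt
    simpa using this
  have hP0 : 0 < P - 1 := by linarith
  -- This is `p'/2`, and `r > 2` is equivalent to `P < 4/3` for `P > 1`.
  set r : ℝ := P / (2 * (P - 1)) with hr
  have hr2 : 2 < r := by rw [hr, lt_div_iff₀ (by positivity)]; linarith
  have hPr : 2 * r / (2 * r - 1) = P := by
    have : 2 * r - 1 = 1 / (P - 1) := by rw [hr]; field_simp; ring
    rw [this, hr]; field_simp
  have hp'r : p' = ENNReal.ofReal (2 * r) := by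
    have hc : ENNReal.HolderConjugate (ENNReal.ofReal P) (ENNReal.ofReal (2 * r)) := by
      refine Real.HolderConjugate.ennrealOfReal ?_
      rw [Real.holderConjugate_iff]
      refine ⟨hP1, ?_⟩
      rw [hr]; field_simp; ring
    rw [← hpP] at hc
    exact ENNReal.HolderConjugate.unique p p' (ENNReal.ofReal (2 * r))
  obtain ⟨C, hC⟩ := exists_eLpNorm_maximalFunction_fourier_le hr2
    (hμ (ENNReal.ofReal r)
      (by rw [← ENNReal.ofReal_ofNat 2]; exact (ENNReal.ofReal_lt_ofReal_iff (by linarith)).2 hr2)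
      ENNReal.ofReal_lt_top)
  -- Hölder from `2r/3` down to `q` costs the length `2π` to a power at most `1`; bounding it by
  -- `2π` keeps the constant independent of `q`.
  refine ⟨C * (2 * Real.pi).toNNReal, fun q hq hq3 f hf _ => ?_⟩
  have hqr : q ≤ ENNReal.ofReal (2 * r / 3) := by
    rw [ENNReal.ofReal_div_of_pos (by norm_num), ← hp'r, ENNReal.le_div_iff_mul_le (by simp) (by simp),
      mul_comm]
    simpa using hq3
  have hqtop : q ≠ ∞ := (hqr.trans_lt ENNReal.ofReal_lt_top).ne
  have hexp : 1 / q.toReal - 1 / (ENNReal.ofReal (2 * r / 3)).toReal ≤ 1 := by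
    have h1 : 1 ≤ q.toReal := by
      rw [← ENNReal.toReal_one]; exact ENNReal.toReal_mono hqtop hq
    have h2 : 1 / q.toReal ≤ 1 := by rw [div_le_one (by linarith)]; exact h1
    have h3 : 0 ≤ 1 / (ENNReal.ofReal (2 * r / 3)).toReal := by positivity
    linarith
  have h := hC f hf
  rw [hPr, ← hpP] at h
  calc _ ≤ _ := eLpNorm_le_eLpNorm_mul_rpow_measure_univ hqr
        (measurable_maximalFunction_fourier hf).aestronglyMeasurable
    _ ≤ C * eLpNorm f p volume * ENNReal.ofReal (2 * Real.pi) :=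
        mul_le_mul' h (circleMeasure_univ_rpow_le hexp)
    _ = _ := by
        rw [ENNReal.coe_mul, mul_right_comm]; rfl
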